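/- Let $k$ be a field, let $a\ge 2$ be an integer, let $q\in k$ be a primitive $a$-th root of unity, and let $$A=A_{a,q}=k\langle X,Y\rangle/(X^a,\;XY-qYX,\;Y^a).$$ For $n\ge 0$ let $\mathrm{HH}^n(A)=\mathrm{Ext}^n_{A^e}(A,A)$ be the $n$-th Hochschild cohomology of $A$, where $A^e=A\otimes_k A^{\mathrm{op}}$ acts on $A$ by $(b\otimes c)\cdot m=bmc$. Then, for every $n\ge 0$, the $k$-vector space $\mathrm{HH}^n(A)$ is finite-dimensional with $$\dim_k \mathrm{HH}^n(A)=2n+2.$$ In particular, $\dim_k \mathrm{HH}^n(A)$ is independent of $a$: if $a,b\ge 2$ are integers and $q,r\in k$ are primitive roots of unity of orders $a$ and $b$ respectively, then $\dim_k\mathrm{HH}^n(A_{a,q})=\dim_k\mathrm{HH}^n(A_{b,r})$ for all $n\ge 0$. -/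

import Mathlib

open CategoryTheory

/-- The defining relations `X ^ a = 0`, `X Y = q Y X`, `Y ^ a = 0` on the free algebra
`k⟨X, Y⟩`, where `X` is the generator `0` and `Y` is the generator `1`. -/
inductive QCIRel (k : Type*) [Field k] (a : ℕ) (q : k) :
    FreeAlgebra k (Fin 2) → FreeAlgebra k (Fin 2) → Prop
  | x_pow : QCIRel k a q (FreeAlgebra.ι k 0 ^ a) 0
  | comm : QCIRel k a q (FreeAlgebra.ι k 0 * FreeAlgebra.ι k 1)
      (q • (FreeAlgebra.ι k 1 * FreeAlgebra.ι k 0))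
  | y_pow : QCIRel k a q (FreeAlgebra.ι k 1 ^ a) 0

/-- The quantum complete intersection `k⟨X, Y⟩ / (X ^ a, X Y - q Y X, Y ^ a)`. -/
abbrev QCI (k : Type*) [Field k] (a : ℕ) (q : k) : Type _ :=
  RingQuot (QCIRel k a q)

/-- The enveloping algebra `A ⊗ Aᵒᵖ` of a `k`-algebra `A`. -/
abbrev EnvelopingAlgebra (k A : Type*) [Field k] [Ring A] [Algebra k A] : Type _ :=
  TensorProduct k A Aᵐᵒᵖ

/-- `A` as a left module over its enveloping algebra, `(b ⊗ c) • m = b * m * c`. -/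
noncomputable def regularBimodule (k A : Type*) [Field k] [Ring A] [Algebra k A] :
    ModuleCat (EnvelopingAlgebra k A) :=
  letI : Module (EnvelopingAlgebra k A) A := instModuleTensorProductMop k A
  ModuleCat.of (EnvelopingAlgebra k A) A

universe u

/-- Hochschild cohomology `HHⁿ(A) = Extⁿ(A, A)` over the enveloping algebra,
with its structure of a `k`-vector space. -/
noncomputable def HochschildCohomology (k A : Type u) [Field k] [Ring A] [Algebra k A]
    (n : ℕ) : ModuleCat.{u} k :=
  ((Ext k (ModuleCat.{u} (EnvelopingAlgebra k A)) n).obj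
    (Opposite.op (regularBimodule k A))).obj (regularBimodule k A)

/-! The monomials `Y ^ u * X ^ v` with `u, v < a` form a basis of `A`. For the truncated polynomial
algebra in one variable the bimodule resolution is 2-periodic: its maps are multiplication by `x -
ξ` and by the norm element `∑ x ^ s * ξ ^ (a - 1 - s)`, where `x` and `ξ` are left and right
multiplication by the variable. Two such resolutions, one for `X` and one for `Y`, combine into a
double complex with one copy of `A ⊗ Aᵒᵖ` at each position `(i, j)`. Because `X` and `Y` only
commute up to `q`, each differential is twisted by `1` or `q` according to the parity of the other
degree; parity suffices since `q ^ a = 1`. The total complex has `n + 1` free generators in degree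
`n`, and explicit contracting homotopies (`hX_mul_dX_add`, `hY_mul_dY_add`, `hX_mul_dY`,
`eq_add_of_origin`) show that it resolves `A`.

Applying `Hom(-, A)` gives a double complex with `A` at every position. In monomial bases shifted by
the parities of `i` and `j`, all differentials are diagonal (`act_dX_shiftedBasis`,
`act_dY_shiftedBasis`), so the complex splits into `a ^ 2` double complexes with one-dimensional
entries. Primitivity of `q` makes all but two of these acyclic, either rowwise or columnwise
(`exists_totalDelta_coef_eq`). In the remaining two, at exponents `(0, 0)` and `(a - 1, a - 1)`,
every differential vanishes (`coefX_survivor`, `coefY_survivor`). Each contributes `n + 1`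
dimensions in degree `n`, hence `2 * n + 2` in total. -/

open scoped TensorProduct
open MulOpposite

/-! ### Monomial bases of the quantum complete intersection. -/

namespace QCI

section Algebra

variable {k : Type*} [Field k] {a : ℕ} {q : k}

/-- The generator `X`. -/
noncomputable def X (k : Type*) [Field k] (a : ℕ) (q : k) : QCI k a q :=
  RingQuot.mkAlgHom k (QCIRel k a q) (FreeAlgebra.ι k 0)

/-- The generator `Y`. -/
noncomputable def Y (k : Type*) [Field k] (a : ℕ) (q : k) : QCI k a q :=
  RingQuot.mkAlgHom k (QCIRel k a q) (FreeAlgebra.ι k 1)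

lemma X_pow : X k a q ^ a = 0 := by
  have h := RingQuot.mkAlgHom_rel k (QCIRel.x_pow (k := k) (a := a) (q := q))
  simp only [map_pow, map_zero] at h
  exact h

lemma Y_pow : Y k a q ^ a = 0 := by
  have h := RingQuot.mkAlgHom_rel k (QCIRel.y_pow (k := k) (a := a) (q := q))
  simp only [map_pow, map_zero] at h
  exact h

lemma X_mul_Y : X k a q * Y k a q = q • (Y k a q * X k a q) := by
  have h := RingQuot.mkAlgHom_rel k (QCIRel.comm (k := k) (a := a) (q := q))
  simp only [map_mul, map_smul] at h
  exact h

lemma X_pow_mul_Y (v : ℕ) : X k a q ^ v * Y k a q = q ^ v • (Y k a q * X k a q ^ v) := by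
  induction v with
  | zero => simp
  | succ v ih =>
    rw [pow_succ', mul_assoc, ih, mul_smul_comm, ← mul_assoc, X_mul_Y, smul_mul_assoc, smul_smul,
      mul_assoc, ← pow_succ]

lemma X_mul_Y_pow (u : ℕ) : X k a q * Y k a q ^ u = q ^ u • (Y k a q ^ u * X k a q) := by
  induction u with
  | zero => simp
  | succ v ih =>
    rw [pow_succ, ← mul_assoc, ih, smul_mul_assoc, mul_assoc, X_mul_Y, mul_smul_comm, smul_smul,
      ← pow_succ, mul_assoc]

lemma X_pow_mul_Y_pow (u v : ℕ) :
    X k a q ^ v * Y k a q ^ u = q ^ (u * v) • (Y k a q ^ u * X k a q ^ v) := by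
  induction v with
  | zero => simp
  | succ v ih =>
    rw [pow_succ', mul_assoc, ih, mul_smul_comm, ← mul_assoc, X_mul_Y_pow, smul_mul_assoc,
      smul_smul, mul_assoc, ← pow_add, Nat.mul_succ]

lemma X_pow_eq_zero {v : ℕ} (h : a ≤ v) : X k a q ^ v = 0 := pow_eq_zero_of_le h X_pow

lemma Y_pow_eq_zero {u : ℕ} (h : a ≤ u) : Y k a q ^ u = 0 := pow_eq_zero_of_le h Y_pow

/-- A subspace containing `1` and stable under left multiplication by the generators is
everything. -/
lemma submodule_eq_top (S : Submodule k (QCI k a q)) (h1 : 1 ∈ S)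
    (hX : ∀ s ∈ S, X k a q * s ∈ S) (hY : ∀ s ∈ S, Y k a q * s ∈ S) : S = ⊤ := by
  have key : ∀ f : FreeAlgebra k (Fin 2), ∀ s ∈ S, RingQuot.mkAlgHom k (QCIRel k a q) f * s ∈ S := by
    intro f
    induction f using FreeAlgebra.induction with
    | grade0 r =>
      intro s hs
      rw [AlgHom.commutes, ← Algebra.smul_def]
      exact S.smul_mem _ hs
    | grade1 i =>
      intro s hs
      fin_cases i
      · exact hX s hs
      · exact hY s hs
    | mul f g hf hg =>
      intro s hs
      rw [map_mul, mul_assoc]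
      exact hf _ (hg _ hs)
    | add f g hf hg =>
      intro s hs
      rw [map_add, add_mul]
      exact S.add_mem (hf _ hs) (hg _ hs)
  rw [eq_top_iff]
  intro b _
  obtain ⟨f, rfl⟩ := RingQuot.mkAlgHom_surjective k (QCIRel k a q) b
  simpa using key f 1 h1

lemma span_monomials : (⊤ : Submodule k (QCI k a q)) ≤ Submodule.span k
    (Set.range fun p : Fin a × Fin a => Y k a q ^ (p.1 : ℕ) * X k a q ^ (p.2 : ℕ)) := by
  have hmem : ∀ u v : ℕ, Y k a q ^ u * X k a q ^ v ∈ Submodule.span k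
      (Set.range fun p : Fin a × Fin a => Y k a q ^ (p.1 : ℕ) * X k a q ^ (p.2 : ℕ)) := by
    intro u v
    by_cases hu : u < a
    · by_cases hv : v < a
      · exact Submodule.subset_span ⟨(⟨u, hu⟩, ⟨v, hv⟩), rfl⟩
      · rw [X_pow_eq_zero (not_lt.1 hv), mul_zero]; exact Submodule.zero_mem _
    · rw [Y_pow_eq_zero (not_lt.1 hu), zero_mul]; exact Submodule.zero_mem _
  refine (submodule_eq_top _ ?_ ?_ ?_).ge
  · simpa using hmem 0 0
  · intro s hs
    induction hs using Submodule.span_induction with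
    | mem s hs =>
      obtain ⟨p, rfl⟩ := hs
      dsimp only
      rw [← mul_assoc, X_mul_Y_pow, smul_mul_assoc, mul_assoc, ← pow_succ']
      exact Submodule.smul_mem _ _ (hmem _ _)
    | zero => rw [mul_zero]; exact Submodule.zero_mem _
    | add s t _ _ hs ht => rw [mul_add]; exact Submodule.add_mem _ hs ht
    | smul r s _ hs => rw [mul_smul_comm]; exact Submodule.smul_mem _ _ hs
  · intro s hs
    induction hs using Submodule.span_induction with
    | mem s hs =>
      obtain ⟨p, rfl⟩ := hs
      dsimp only
      rw [← mul_assoc, ← pow_succ']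
      exact hmem _ _
    | zero => rw [mul_zero]; exact Submodule.zero_mem _
    | add s t _ _ hs ht => rw [mul_add]; exact Submodule.add_mem _ hs ht
    | smul r s _ hs => rw [mul_smul_comm]; exact Submodule.smul_mem _ _ hs

/-- The action of `X` on functions on the quadrant, dual to multiplication on monomials. -/
def repX (a : ℕ) (q : k) : Module.End k (ℕ × ℕ → k) where
  toFun f p := if p.2 + 1 < a then (q⁻¹) ^ p.1 * f (p.1, p.2 + 1) else 0
  map_add' f g := by
    ext p; simp only [Pi.add_apply]; split_ifs <;> ring
  map_smul' r f := by
    ext p; simp only [Pi.smul_apply, smul_eq_mul, RingHom.id_apply]; split_ifs <;> ring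

/-- The action of `Y` on functions on the quadrant, dual to multiplication on monomials. -/
def repY (k : Type*) [Field k] (a : ℕ) : Module.End k (ℕ × ℕ → k) where
  toFun f p := if p.1 + 1 < a then f (p.1 + 1, p.2) else 0
  map_add' f g := by
    ext p; simp only [Pi.add_apply]; split_ifs <;> ring
  map_smul' r f := by
    ext p; simp only [Pi.smul_apply, smul_eq_mul, RingHom.id_apply]; split_ifs <;> ring

lemma repX_pow_apply (m : ℕ) (f : ℕ × ℕ → k) (u v : ℕ) :
    (repX a q ^ (m + 1)) f (u, v) =
      if v + m + 1 < a then (q⁻¹) ^ (u * (m + 1)) * f (u, v + m + 1) else 0 := by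
  induction m generalizing v with
  | zero => simp [repX]
  | succ m ih =>
    rw [pow_succ', Module.End.mul_apply]
    change (if v + 1 < a then (q⁻¹) ^ u * (repX a q ^ (m + 1)) f (u, v + 1) else 0) = _
    rw [ih, show v + 1 + m + 1 = v + (m + 1) + 1 by ring]
    split_ifs <;> first | omega | ring

lemma repY_pow_apply (m : ℕ) (f : ℕ × ℕ → k) (u v : ℕ) :
    (repY k a ^ (m + 1)) f (u, v) = if u + m + 1 < a then f (u + m + 1, v) else 0 := by
  induction m generalizing u with
  | zero => simp [repY]
  | succ m ih =>
    rw [pow_succ', Module.End.mul_apply]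
    change (if u + 1 < a then (repY k a ^ (m + 1)) f (u + 1, v) else 0) = _
    rw [ih, show u + 1 + m + 1 = u + (m + 1) + 1 by ring]
    split_ifs <;> first | omega | rfl

/-- The representation of the quantum complete intersection on functions on the quadrant. -/
noncomputable def rep (ha : 1 ≤ a) (hq : q ≠ 0) : QCI k a q →ₐ[k] Module.End k (ℕ × ℕ → k) :=
  RingQuot.liftAlgHom k ⟨FreeAlgebra.lift k ![repX a q, repY k a], by
    obtain ⟨m, rfl⟩ := Nat.exists_eq_add_of_le' ha
    intro s t h
    cases h with
    | x_pow =>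
      ext1 f; funext ⟨u, v⟩
      simp [repX_pow_apply, show ¬ (v + m < m) by omega]
    | y_pow =>
      ext1 f; funext ⟨u, v⟩
      simp [repY_pow_apply, show ¬ (u + m < m) by omega]
    | comm =>
      ext1 f; funext ⟨u, v⟩
      simp only [repX, repY, map_mul, map_smul, FreeAlgebra.lift_ι_apply, Matrix.cons_val_zero,
        Matrix.cons_val_one, Module.End.mul_apply, LinearMap.coe_mk, AddHom.coe_mk,
        LinearMap.smul_apply, Pi.smul_apply, smul_eq_mul]
      split_ifs
      · rw [pow_succ]; field_simp
      all_goals simp⟩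

lemma rep_X (ha : 1 ≤ a) (hq : q ≠ 0) : rep ha hq (X k a q) = repX a q := by
  simp [rep, X]

lemma rep_Y (ha : 1 ≤ a) (hq : q ≠ 0) : rep ha hq (Y k a q) = repY k a := by
  simp [rep, Y]

/-- Evaluation at the origin turns each monomial into a nonzero multiple of evaluation at its
exponents, so delta functions separate the monomials. -/
lemma rep_monomial (ha : 1 ≤ a) (hq : q ≠ 0) (u v : ℕ) (hu : u < a) (hv : v < a)
    (f : ℕ × ℕ → k) :
    rep ha hq (Y k a q ^ u * X k a q ^ v) f (0, 0) = (q⁻¹) ^ (u * v) * f (u, v) := by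
  rw [map_mul, map_pow, map_pow, rep_X, rep_Y, Module.End.mul_apply]
  have hx : (repX a q ^ v) f (u, 0) = (q⁻¹) ^ (u * v) * f (u, v) := by
    cases v with
    | zero => simp
    | succ v => rw [repX_pow_apply]; simp [hv]
  cases u with
  | zero => simpa using hx
  | succ u => rw [repY_pow_apply]; simp [hu, hx]

lemma linearIndependent_monomials (ha : 1 ≤ a) (hq : q ≠ 0) : LinearIndependent k
    (fun p : Fin a × Fin a => Y k a q ^ (p.1 : ℕ) * X k a q ^ (p.2 : ℕ)) := by
  rw [Fintype.linearIndependent_iff]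
  intro g hg p
  have h := congrArg (fun b => rep ha hq b (Pi.single ((p.1 : ℕ), (p.2 : ℕ)) 1) (0, 0)) hg
  simp only [map_sum, map_smul, LinearMap.sum_apply, LinearMap.smul_apply, Finset.sum_apply,
    Pi.smul_apply, rep_monomial ha hq _ _ (Fin.is_lt _) (Fin.is_lt _), map_zero,
    LinearMap.zero_apply, Pi.zero_apply] at h
  rw [Finset.sum_eq_single p] at h
  · simpa [hq] using h
  · intro r _ hr
    have : ((r.1 : ℕ), (r.2 : ℕ)) ≠ ((p.1 : ℕ), (p.2 : ℕ)) := by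
      intro h; apply hr; ext <;> simp_all
    simp [this]
  · simp

/-- The basis of monomials `Y ^ u X ^ v`. -/
noncomputable def monomialBasis (ha : 1 ≤ a) (hq : q ≠ 0) :
    Module.Basis (Fin a × Fin a) k (QCI k a q) :=
  Module.Basis.mk (linearIndependent_monomials ha hq) span_monomials

lemma monomialBasis_apply (ha : 1 ≤ a) (hq : q ≠ 0) (p : Fin a × Fin a) :
    monomialBasis ha hq p = Y k a q ^ (p.1 : ℕ) * X k a q ^ (p.2 : ℕ) := by
  simp [monomialBasis]

/-- The basis of monomials `X ^ v Y ^ u`. -/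
noncomputable def monomialBasis' (ha : 1 ≤ a) (hq : q ≠ 0) :
    Module.Basis (Fin a × Fin a) k (QCI k a q) :=
  ((monomialBasis ha hq).unitsSMul fun p => Units.mk0 (q ^ ((p.1 : ℕ) * (p.2 : ℕ)))
    (pow_ne_zero _ hq)).reindex (Equiv.prodComm _ _)

lemma monomialBasis'_apply (ha : 1 ≤ a) (hq : q ≠ 0) (p : Fin a × Fin a) :
    monomialBasis' ha hq p = X k a q ^ (p.1 : ℕ) * Y k a q ^ (p.2 : ℕ) := by
  simp [monomialBasis', Module.Basis.unitsSMul_apply, monomialBasis_apply, X_pow_mul_Y_pow,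
    Units.smul_def]

end Algebra

end QCI

/-! ### Norm elements as homogeneous geometric sums. -/

/-- The homogeneous geometric sum `∑ x ^ s * ξ ^ (n - 1 - s)` over `s < n`, for commuting `x`
and `ξ`. -/
def homogGeomSum {R : Type*} [Ring R] (x ξ : R) : ℕ → R
  | 0 => 0
  | n + 1 => x ^ n + ξ * homogGeomSum x ξ n

section HomogGeomSum

variable {R : Type*} [Ring R]

lemma homogGeomSum_succ (x ξ : R) (n : ℕ) :
    homogGeomSum x ξ (n + 1) = x ^ n + ξ * homogGeomSum x ξ n := rfl

lemma homogGeomSum_commute {x ξ z : R} (hx : Commute z x) (hξ : Commute z ξ) (n : ℕ) :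
    Commute z (homogGeomSum x ξ n) := by
  induction n with
  | zero => exact Commute.zero_right z
  | succ n ih => exact (hx.pow_right n).add_right (hξ.mul_right ih)

lemma homogGeomSum_mul_sub {x ξ : R} (h : Commute x ξ) (n : ℕ) :
    homogGeomSum x ξ n * (x - ξ) = x ^ n - ξ ^ n := by
  induction n with
  | zero => simp [homogGeomSum]
  | succ n ih =>
    rw [homogGeomSum_succ, add_mul, mul_assoc, ih, mul_sub, mul_sub, pow_succ, pow_succ',
      (h.pow_left n).eq]
    abel

lemma sub_mul_homogGeomSum {x ξ : R} (h : Commute x ξ) (n : ℕ) :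
    (x - ξ) * homogGeomSum x ξ n = x ^ n - ξ ^ n := by
  rw [← homogGeomSum_mul_sub h, (homogGeomSum_commute ((Commute.refl x).sub_left h.symm)
    (h.sub_left (Commute.refl ξ)) n).eq]

lemma semiconjBy_homogGeomSum {z x₁ x₂ ξ₁ ξ₂ : R} (hx : SemiconjBy z x₁ x₂)
    (hξ : SemiconjBy z ξ₁ ξ₂) (n : ℕ) :
    SemiconjBy z (homogGeomSum x₁ ξ₁ n) (homogGeomSum x₂ ξ₂ n) := by
  induction n with
  | zero => exact SemiconjBy.zero_right z
  | succ n ih => exact (hx.pow_right n).add_right (hξ.mul_right ih)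

lemma homogGeomSum_smul {k : Type*} [Field k] [Algebra k R] (c : k) (x ξ : R) (n : ℕ) :
    homogGeomSum (c • x) (c • ξ) (n + 1) = c ^ n • homogGeomSum x ξ (n + 1) := by
  induction n with
  | zero => simp [homogGeomSum]
  | succ n ih =>
    rw [homogGeomSum_succ, ih, homogGeomSum_succ x ξ (n + 1), smul_pow, smul_add, smul_mul_smul_comm,
      ← pow_succ']

/-- Every summand is a product of `n` factors, and each factor passed advances the index of `T` by
one. -/
lemma homogGeomSum_mul_seq {x ξ ξ' : R} {T : ℕ → R} (hx : ∀ i, x * T i = T (i + 1) * x)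
    (hξ : ∀ i, ξ' * T i = T (i + 1) * ξ) (n : ℕ) :
    homogGeomSum x ξ' (n + 1) * T 0 = T n * homogGeomSum x ξ (n + 1) := by
  have hpow : ∀ n, x ^ n * T 0 = T n * x ^ n := by
    intro n
    induction n with
    | zero => simp
    | succ n ih => rw [pow_succ', mul_assoc, ih, ← mul_assoc, hx, mul_assoc]
  induction n with
  | zero => simp [homogGeomSum]
  | succ n ih =>
    rw [homogGeomSum_succ, add_mul, mul_assoc, ih, hpow, ← mul_assoc, hξ, mul_assoc, ← mul_add,
      ← homogGeomSum_succ]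

end HomogGeomSum


/-! ### Contracting the periodic complex of one truncated variable. -/

namespace EnvelopingAlgebra

section Truncated

variable {k A : Type*} [Field k] [Ring A] [Algebra k A]

/-- Left multiplication operators, as elements of the enveloping algebra. -/
noncomputable def inl (b : A) : EnvelopingAlgebra k A := b ⊗ₜ[k] 1

/-- Right multiplication operators, as elements of the enveloping algebra. -/
noncomputable def inr (b : A) : EnvelopingAlgebra k A := 1 ⊗ₜ[k] op b

lemma inl_mul_inr (b c : A) : inl b * inr (k := k) c = b ⊗ₜ[k] op c := by
  simp [inl, inr]

lemma inl_mul (b c : A) : inl (k := k) (b * c) = inl b * inl c := by simp [inl]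

lemma inr_mul (b c : A) : inr (k := k) (b * c) = inr c * inr b := by simp [inr]

lemma inl_pow (b : A) (n : ℕ) : inl (k := k) (b ^ n) = inl b ^ n := by
  simp [inl, Algebra.TensorProduct.tmul_pow]

lemma inr_pow (b : A) (n : ℕ) : inr (k := k) (b ^ n) = inr b ^ n := by
  simp [inr, Algebra.TensorProduct.tmul_pow]

lemma inl_smul (r : k) (b : A) : inl (k := k) (r • b) = r • inl b := by
  simp [inl, TensorProduct.smul_tmul']

lemma inr_smul (r : k) (b : A) : inr (k := k) (r • b) = r • inr b := by
  simp [inr]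

lemma commute_inl_inr (b c : A) : Commute (inl (k := k) b) (inr c) := by
  simp [Commute, SemiconjBy, inl, inr]

variable {ι : Type*} {a : ℕ} (b : Module.Basis (ι × Fin a) k A) (g : ι → A) (x : A)

/-- For a basis `g t * x ^ v` of `A`, the right linear map sending `g t * x ^ v ⊗ c` to
`(g t ⊗ c) * T v`. -/
noncomputable def coeffMap (T : ℕ → EnvelopingAlgebra k A) :
    EnvelopingAlgebra k A →ₗ[k] EnvelopingAlgebra k A :=
  TensorProduct.lift (b.constr k fun p =>
    LinearMap.mulRight k (T p.2) ∘ₗ TensorProduct.mk k A Aᵐᵒᵖ (g p.1))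

/-- The span of the elements `g t ⊗ c`. -/
def coeffSpan (k : Type*) {A : Type*} [Field k] [Ring A] [Algebra k A] {ι : Type*} (g : ι → A) :
    Submodule k (EnvelopingAlgebra k A) :=
  Submodule.span k (Set.range fun p : ι × A => inl (g p.1) * inr p.2)

variable {b g x}

lemma mul_inr_mem_coeffSpan {m : EnvelopingAlgebra k A} (hm : m ∈ coeffSpan k g) (c : A) :
    m * inr c ∈ coeffSpan k g := by
  induction hm using Submodule.span_induction with
  | mem m hm =>
    obtain ⟨p, rfl⟩ := hm
    refine Submodule.subset_span ⟨(p.1, c * p.2), ?_⟩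
    simp only [inr_mul, mul_assoc]
  | zero => rw [zero_mul]; exact Submodule.zero_mem _
  | add s t _ _ hs ht => rw [add_mul]; exact Submodule.add_mem _ hs ht
  | smul r s _ hs => rw [smul_mul_assoc]; exact Submodule.smul_mem _ _ hs

lemma coeffMap_apply (hb : ∀ p, b p = g p.1 * x ^ (p.2 : ℕ)) (T : ℕ → EnvelopingAlgebra k A)
    {m : EnvelopingAlgebra k A} (hm : m ∈ coeffSpan k g) {v : ℕ} (hv : v < a) :
    coeffMap b g T (m * inl x ^ v) = m * T v := by
  induction hm using Submodule.span_induction with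
  | mem m hm =>
    obtain ⟨⟨t, c⟩, rfl⟩ := hm
    have : inl (k := k) (g t) * inr (k := k) c * inl (k := k) x ^ v = b (t, ⟨v, hv⟩) ⊗ₜ[k] op c := by
      rw [hb, mul_assoc, ← inl_pow, ← (commute_inl_inr _ _).eq, ← mul_assoc, ← inl_mul,
        inl_mul_inr]
    simp only [this]
    rw [coeffMap, TensorProduct.lift.tmul, Module.Basis.constr_basis, inl_mul_inr]
    simp
  | zero => simp
  | add s t _ _ hs ht => rw [add_mul, map_add, hs, ht, add_mul]
  | smul r s _ hs => rw [smul_mul_assoc, map_smul, hs, smul_mul_assoc]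

lemma eq_of_eq_on_coeffSpan {M : Type*} [AddCommGroup M] [Module k M]
    (hb : ∀ p, b p = g p.1 * x ^ (p.2 : ℕ))
    {f f' : EnvelopingAlgebra k A →ₗ[k] M}
    (h : ∀ m ∈ coeffSpan k g, ∀ v < a, f (m * inl x ^ v) = f' (m * inl x ^ v)) : f = f' := by
  apply TensorProduct.ext
  refine b.ext fun p => ?_
  refine LinearMap.ext fun c => ?_
  obtain ⟨c, rfl⟩ := op_surjective c
  have : b p ⊗ₜ[k] op c = inl (k := k) (g p.1) * inr (k := k) c * inl (k := k) x ^ (p.2 : ℕ) := by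
    rw [hb, mul_assoc, ← inl_pow, ← (commute_inl_inr _ _).eq, ← mul_assoc, ← inl_mul,
      inl_mul_inr]
  have h' := h _ (Submodule.subset_span ⟨(p.1, c), rfl⟩) p.2 p.2.2
  dsimp only at h'
  rw [← this] at h'
  simpa using h'

/-- The homotopy from even to odd degrees. -/
noncomputable def evenHomotopy (b : Module.Basis (ι × Fin a) k A) (g : ι → A) (x : A)
    (ξ : EnvelopingAlgebra k A) : EnvelopingAlgebra k A →ₗ[k] EnvelopingAlgebra k A :=
  coeffMap b g (homogGeomSum (inl x) ξ)

/-- The homotopy from odd to even degrees. -/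
noncomputable def oddHomotopy (b : Module.Basis (ι × Fin a) k A) (g : ι → A) :
    EnvelopingAlgebra k A →ₗ[k] EnvelopingAlgebra k A :=
  coeffMap b g (fun v => if v + 1 = a then 1 else 0)

variable (hb : ∀ p, b p = g p.1 * x ^ (p.2 : ℕ)) (hxa : x ^ a = 0)
  {ξ : EnvelopingAlgebra k A} (hξ : Commute (inl x) ξ)
  (hgξ : ∀ m ∈ coeffSpan k g, m * ξ ∈ coeffSpan k g)

include hb

include hξ in
-- The even homotopy is the quotient on division by `x - ξ`; the remainder is obtained by
-- substituting `ξ` for `x`.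
lemma sub_evenHomotopy_mul {m : EnvelopingAlgebra k A} (hm : m ∈ coeffSpan k g) {v : ℕ}
    (hv : v < a) : (m * inl x ^ v) - evenHomotopy b g x ξ (m * inl x ^ v) * (inl x - ξ) =
      m * ξ ^ v := by
  rw [evenHomotopy, coeffMap_apply hb _ hm hv, mul_assoc, homogGeomSum_mul_sub hξ, mul_sub,
    sub_sub_cancel]

include hξ hgξ hxa in
lemma oddHomotopy_mul_add_evenHomotopy (z : EnvelopingAlgebra k A) :
    oddHomotopy b g z * homogGeomSum (inl x) ξ a + evenHomotopy b g x ξ (z * (inl x - ξ)) = z := by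
  suffices h : LinearMap.mulRight k (homogGeomSum (inl x) ξ a) ∘ₗ oddHomotopy b g +
      evenHomotopy b g x ξ ∘ₗ LinearMap.mulRight k (inl x - ξ) = LinearMap.id from
    LinearMap.congr_fun h z
  refine eq_of_eq_on_coeffSpan hb fun m hm v hv => ?_
  have e : m * inl x ^ v * (inl x - ξ) = m * inl x ^ (v + 1) - m * ξ * inl x ^ v := by
    rw [mul_sub, mul_assoc, ← pow_succ, mul_assoc, (hξ.pow_left v).eq, mul_assoc]
  simp only [LinearMap.add_apply, LinearMap.comp_apply, LinearMap.mulRight_apply, LinearMap.id_apply,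
    e, map_sub, oddHomotopy, evenHomotopy, coeffMap_apply hb _ hm hv,
    coeffMap_apply hb _ (hgξ m hm) hv]
  -- The recursion for the geometric sums makes the two even terms differ by `m * x ^ v`. Only at
  -- the top power, where `x ^ a = 0` removes one of them, is the odd homotopy needed.
  by_cases h : v + 1 = a
  · subst h
    rw [← inl_pow x (v + 1), hxa, if_pos rfl, homogGeomSum_succ, mul_one, mul_add, mul_assoc]
    simp [inl]
  · rw [coeffMap_apply hb _ hm (by omega), homogGeomSum_succ, if_neg h]
    simp [mul_add, mul_assoc]

include hxa in
lemma oddHomotopy_mul_pow {m : EnvelopingAlgebra k A} (hm : m ∈ coeffSpan k g) (w : ℕ) :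
    oddHomotopy b g (m * inl x ^ w) = if w + 1 = a then m else 0 := by
  by_cases h : w < a
  · rw [oddHomotopy, coeffMap_apply hb _ hm h]
    split_ifs <;> simp
  · rw [← inl_pow, pow_eq_zero_of_le (not_lt.1 h) hxa, if_neg (by omega)]
    simp [inl]

include hxa hξ hgξ in
-- The odd homotopy extracts the coefficient of `x ^ (a - 1)`, so only the summand `x ^ s * ξ ^ (n -
-- 1 - s)` with `s = a - 1 - w` contributes. For `n = a` the result is exactly the remainder left by
-- the even homotopy.
lemma oddHomotopy_mul_homogGeomSum (n w : ℕ) (hw : w < a) {m : EnvelopingAlgebra k A}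
    (hm : m ∈ coeffSpan k g) :
    oddHomotopy b g (m * inl x ^ w * homogGeomSum (inl x) ξ n) =
      if a ≤ w + n then m * ξ ^ (w + n - a) else 0 := by
  induction n generalizing m with
  | zero => rw [if_neg (by omega)]; simp [homogGeomSum]
  | succ n ih =>
    have e : m * inl x ^ w * homogGeomSum (inl x) ξ (n + 1) = m * inl x ^ (w + n) +
        m * ξ * inl x ^ w * homogGeomSum (inl x) ξ n := by
      rw [homogGeomSum_succ, mul_add, mul_assoc, ← pow_add]
      simp only [← mul_assoc]
      rw [mul_assoc m _ ξ, (hξ.pow_left w).eq, ← mul_assoc]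
    rw [e, map_add, ih (hgξ m hm), oddHomotopy_mul_pow hb hxa hm]
    rcases lt_trichotomy (w + n + 1) a with h | h | h
    · rw [if_neg (by omega), if_neg (by omega), if_neg (by omega), zero_add]
    · rw [if_pos h, if_neg (by omega), if_pos (by omega), show w + (n + 1) - a = 0 by omega]
      simp
    · rw [if_neg (by omega), if_pos (by omega), if_pos (by omega),
        show w + (n + 1) - a = (w + n - a) + 1 by omega, zero_add, mul_assoc, pow_succ']

include hξ hgξ hxa in
lemma evenHomotopy_mul_add_oddHomotopy (z : EnvelopingAlgebra k A) :
    evenHomotopy b g x ξ z * (inl x - ξ) + oddHomotopy b g (z * homogGeomSum (inl x) ξ a) = z := by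
  suffices h : LinearMap.mulRight k (inl x - ξ) ∘ₗ evenHomotopy b g x ξ +
      oddHomotopy b g ∘ₗ LinearMap.mulRight k (homogGeomSum (inl x) ξ a) = LinearMap.id from
    LinearMap.congr_fun h z
  refine eq_of_eq_on_coeffSpan hb fun m hm v hv => ?_
  simp only [LinearMap.add_apply, LinearMap.comp_apply, LinearMap.mulRight_apply,
    LinearMap.id_apply]
  rw [oddHomotopy_mul_homogGeomSum hb hxa hξ hgξ a v hv hm, if_pos (by omega),
    Nat.add_sub_cancel, ← sub_evenHomotopy_mul hb hξ hm hv]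
  abel

end Truncated

end EnvelopingAlgebra

namespace EnvelopingAlgebra

variable {k A : Type*} [Field k] [Ring A] [Algebra k A]
variable {ι : Type*} {a : ℕ} {b : Module.Basis (ι × Fin a) k A} {g : ι → A} {x : A}

/-- Moving `y` to the left of `x ^ v` costs `r ^ v`; the hypothesis on `T` and `T'` absorbs this
factor. It is the source of every commutation rule between the homotopies in one variable and
multiplication by the other. -/
lemma coeffMap_mul (hb : ∀ p, b p = g p.1 * x ^ (p.2 : ℕ)) {y y' : EnvelopingAlgebra k A} {r : k}
    {T T' : ℕ → EnvelopingAlgebra k A} (hy : ∀ m ∈ coeffSpan k g, m * y ∈ coeffSpan k g)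
    (hxy : inl x * y = r • (y * inl x)) (hT : ∀ v < a, r ^ v • (y * T v) = T' v * y')
    (z : EnvelopingAlgebra k A) : coeffMap b g T (z * y) = coeffMap b g T' z * y' := by
  have hpow : ∀ v, inl x ^ v * y = r ^ v • (y * inl x ^ v) := by
    intro v
    induction v with
    | zero => simp
    | succ v ih =>
      rw [pow_succ', mul_assoc, ih, mul_smul_comm, ← mul_assoc, hxy, smul_mul_assoc, smul_smul,
        mul_assoc, pow_succ r v]
  suffices h : coeffMap b g T ∘ₗ LinearMap.mulRight k y =
      LinearMap.mulRight k y' ∘ₗ coeffMap b g T' from LinearMap.congr_fun h z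
  refine eq_of_eq_on_coeffSpan hb fun m hm v hv => ?_
  simp only [LinearMap.comp_apply, LinearMap.mulRight_apply]
  rw [mul_assoc, hpow, mul_smul_comm, map_smul, ← mul_assoc, coeffMap_apply hb _ (hy m hm) hv,
    coeffMap_apply hb _ hm hv, mul_assoc, mul_assoc, ← hT v hv, mul_smul_comm]

end EnvelopingAlgebra

lemma map_mul_homogGeomSum {R F : Type*} [Ring R] [FunLike F R R] [AddMonoidHomClass F R R]
    {H : ℕ → F} {y₁ y₂ η₁ η₂ : R}
    (hy : ∀ i z, H i (z * y₁) = H (i + 1) z * y₂) (hη : ∀ i z, H i (z * η₁) = H (i + 1) z * η₂)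
    (n i : ℕ) (z : R) :
    H i (z * homogGeomSum y₁ η₁ (n + 1)) = H (i + n) z * homogGeomSum y₂ η₂ (n + 1) := by
  have hpow : ∀ n i z, H i (z * y₁ ^ n) = H (i + n) z * y₂ ^ n := by
    intro n
    induction n with
    | zero => simp
    | succ n ih =>
      intro i z
      rw [pow_succ', ← mul_assoc, ih, hy, mul_assoc, ← pow_succ', show i + n + 1 = i + (n + 1) by ring]
  induction n generalizing z with
  | zero => simp [homogGeomSum]
  | succ n ih =>
    rw [homogGeomSum_succ, mul_add, map_add, ← mul_assoc, ih, hpow, hη,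
      homogGeomSum_succ y₂ η₂ (n + 1), mul_add, mul_assoc, show i + n + 1 = i + (n + 1) by ring]

/-! ### The twisted double complex over the enveloping algebra. -/

namespace QCI

open EnvelopingAlgebra

variable {k : Type*} [Field k] {a : ℕ} {q : k}

/-- The twisting scalar attached to a degree. -/
def twist (q : k) (j : ℕ) : k := if Even j then 1 else q

lemma twist_pow (hqa : q ^ a = 1) (j : ℕ) : twist q j ^ a = 1 := by
  unfold twist; split_ifs <;> simp [hqa]

variable (k a q) in
/-- Multiplication by `X` on the left. -/
noncomputable abbrev xl : EnvelopingAlgebra k (QCI k a q) := inl (X k a q)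

variable (k a q) in
/-- Multiplication by `X` on the right. -/
noncomputable abbrev xr : EnvelopingAlgebra k (QCI k a q) := inr (X k a q)

variable (k a q) in
/-- Multiplication by `Y` on the left. -/
noncomputable abbrev yl : EnvelopingAlgebra k (QCI k a q) := inl (Y k a q)

variable (k a q) in
/-- Multiplication by `Y` on the right. -/
noncomputable abbrev yr : EnvelopingAlgebra k (QCI k a q) := inr (Y k a q)

lemma xl_mul_yl : xl k a q * yl k a q = q • (yl k a q * xl k a q) := by
  rw [← inl_mul, X_mul_Y, inl_smul, inl_mul]

lemma yr_mul_xr : yr k a q * xr k a q = q • (xr k a q * yr k a q) := by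
  rw [← inr_mul, X_mul_Y, inr_smul, inr_mul]

lemma xl_pow : xl k a q ^ a = 0 := by rw [← inl_pow, X_pow]; simp [inl]
lemma yl_pow : yl k a q ^ a = 0 := by rw [← inl_pow, Y_pow]; simp [inl]
lemma xr_pow : xr k a q ^ a = 0 := by rw [← inr_pow, X_pow]; simp [inr]
lemma yr_pow : yr k a q ^ a = 0 := by rw [← inr_pow, Y_pow]; simp [inr]

variable (k a q) in
/-- The element of the enveloping algebra giving the differential in the `X` direction,
from position `(i + 1, j)` to position `(i, j)`. -/
noncomputable def dX (i j : ℕ) : EnvelopingAlgebra k (QCI k a q) :=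
  if Even i then xl k a q - twist q j • xr k a q
  else homogGeomSum (xl k a q) (twist q j • xr k a q) a

variable (k a q) in
/-- The element of the enveloping algebra giving the differential in the `Y` direction,
from position `(i, j + 1)` to position `(i, j)`. -/
noncomputable def dY (i j : ℕ) : EnvelopingAlgebra k (QCI k a q) :=
  if Even j then twist q i • yl k a q - yr k a q
  else homogGeomSum (twist q i • yl k a q) (yr k a q) a

lemma commute_xl_smul_xr (c : k) : Commute (xl k a q) (c • xr k a q) :=
  (commute_inl_inr _ _).smul_right c

lemma commute_smul_yl_yr (c : k) : Commute (c • yl k a q) (yr k a q) :=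
  (commute_inl_inr _ _).smul_left c

lemma dX_mul_dX (i j : ℕ) : dX k a q (i + 1) j * dX k a q i j = 0 := by
  have h := commute_xl_smul_xr (a := a) (q := q) (twist q j)
  unfold dX
  by_cases hi : Even i
  · rw [if_neg (by simpa [Nat.even_add_one] using hi), if_pos hi, homogGeomSum_mul_sub h, smul_pow,
      xl_pow, xr_pow, smul_zero, sub_zero]
  · rw [if_pos (by simpa [Nat.even_add_one] using hi), if_neg hi, sub_mul_homogGeomSum h, smul_pow,
      xl_pow, xr_pow, smul_zero, sub_zero]

lemma dY_mul_dY (i j : ℕ) : dY k a q i (j + 1) * dY k a q i j = 0 := by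
  have h := commute_smul_yl_yr (a := a) (q := q) (twist q i)
  unfold dY
  by_cases hj : Even j
  · rw [if_neg (by simpa [Nat.even_add_one] using hj), if_pos hj, homogGeomSum_mul_sub h, smul_pow,
      yl_pow, yr_pow, smul_zero, sub_zero]
  · rw [if_pos (by simpa [Nat.even_add_one] using hj), if_neg hj, sub_mul_homogGeomSum h, smul_pow,
      yl_pow, yr_pow, smul_zero, sub_zero]

lemma xl_mul_sub (d : k) : xl k a q * (d • yl k a q - yr k a q) =
    ((q * d) • yl k a q - yr k a q) * xl k a q := by
  rw [mul_sub, sub_mul, mul_smul_comm, xl_mul_yl, (commute_inl_inr _ _).eq, smul_mul_assoc,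
    smul_smul, mul_comm d]

lemma smul_xr_mul_sub (c d : k) : ((q * c) • xr k a q) * (d • yl k a q - yr k a q) =
    ((q * d) • yl k a q - yr k a q) * (c • xr k a q) := by
  rw [mul_sub, sub_mul, smul_mul_smul_comm, smul_mul_smul_comm, smul_mul_assoc, mul_smul_comm,
    yr_mul_xr, smul_smul, (commute_inl_inr _ _).eq]
  congr 2 <;> ring

lemma xl_mul_homogGeomSum (d : k) (n : ℕ) :
    xl k a q * homogGeomSum (d • yl k a q) (yr k a q) n =
      homogGeomSum ((q * d) • yl k a q) (yr k a q) n * xl k a q := by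
  refine semiconjBy_homogGeomSum ?_ (commute_inl_inr _ _).semiconjBy n
  rw [SemiconjBy, mul_smul_comm, xl_mul_yl, smul_smul, smul_mul_assoc, mul_comm]

/-- Moving `xr` past the sum replaces `yr` by `q⁻¹ • yr`. Since the sum is homogeneous of degree
`n`, pulling out `q ^ n` turns this into a rescaling of `yl` by `q`. -/
lemma smul_xr_mul_homogGeomSum (hq : q ≠ 0) (c d : k) (n : ℕ) :
    ((q ^ n * c) • xr k a q) * homogGeomSum (d • yl k a q) (yr k a q) (n + 1) =
      homogGeomSum ((q * d) • yl k a q) (yr k a q) (n + 1) * (c • xr k a q) := by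
  have h : homogGeomSum ((q * d) • yl k a q) (yr k a q) (n + 1) =
      q ^ n • homogGeomSum (d • yl k a q) (q⁻¹ • yr k a q) (n + 1) := by
    rw [← homogGeomSum_smul, smul_smul, smul_smul, mul_inv_cancel₀ hq, one_smul]
  have h' : SemiconjBy (xr k a q) (homogGeomSum (d • yl k a q) (yr k a q) (n + 1))
      (homogGeomSum (d • yl k a q) (q⁻¹ • yr k a q) (n + 1)) := by
    refine semiconjBy_homogGeomSum ((commute_inl_inr _ _).symm.smul_right d).semiconjBy ?_ _
    rw [SemiconjBy, smul_mul_assoc, yr_mul_xr, smul_smul, inv_mul_cancel₀ hq, one_smul]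
  rw [h, smul_mul_smul_comm, smul_mul_assoc, h'.eq]

lemma twist_even {j : ℕ} (h : Even j) : twist q j = 1 := if_pos h
lemma twist_odd {j : ℕ} (h : ¬ Even j) : twist q j = q := if_neg h

lemma twist_succ_even {j : ℕ} (h : Even j) : twist q (j + 1) = q * twist q j := by
  rw [twist_even h, twist_odd (by simpa [Nat.even_add_one] using h), mul_one]

/-- A norm element has degree `a - 1`, so crossing it multiplies a twist by `q ^ (a - 1) = q⁻¹`;
this brings the twist back from `q` to `1`. -/
lemma twist_succ_odd {n : ℕ} (hqa : q ^ (n + 1) = 1) {j : ℕ} (h : ¬ Even j) :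
    twist q (j + 1) = q ^ n * twist q j := by
  rw [twist_odd h, twist_even (by simpa [Nat.even_add_one] using h), ← pow_succ, hqa]

/-- A differential of degree `1` or `a - 1` in one variable rescales the twist of the other by `q`
or `q ^ (a - 1)`, which is precisely the change of `twist` from one degree to the next. -/
lemma dX_mul_dY (ha : 1 ≤ a) (hqa : q ^ a = 1) (i j : ℕ) :
    dX k a q i (j + 1) * dY k a q i j = dY k a q (i + 1) j * dX k a q i j := by
  have hq : q ≠ 0 := by rintro rfl; simp [show a ≠ 0 by omega] at hqa
  obtain ⟨n, rfl⟩ := Nat.exists_eq_add_of_le' ha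
  unfold dX dY
  by_cases hj : Even j
  · rw [if_pos hj, if_pos hj, twist_succ_even hj]
    by_cases hi : Even i
    · rw [if_pos hi, if_pos hi, twist_succ_even hi, sub_mul, xl_mul_sub, smul_xr_mul_sub, ← mul_sub]
    · rw [if_neg hi, if_neg hi, twist_succ_odd hqa hi]
      have := homogGeomSum_mul_seq (x := xl k (n + 1) q) (ξ := twist q j • xr k (n + 1) q)
        (ξ' := (q * twist q j) • xr k (n + 1) q)
        (T := fun m => (q ^ m * twist q i) • yl k (n + 1) q - yr k (n + 1) q)
        (fun m => by rw [xl_mul_sub, ← mul_assoc, ← pow_succ'])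
        (fun m => by rw [smul_xr_mul_sub, ← mul_assoc, ← pow_succ']) n
      simpa using this
  · rw [if_neg hj, if_neg hj, twist_succ_odd hqa hj]
    by_cases hi : Even i
    · rw [if_pos hi, if_pos hi, twist_succ_even hi, sub_mul, xl_mul_homogGeomSum,
        smul_xr_mul_homogGeomSum hq, ← mul_sub]
    · rw [if_neg hi, if_neg hi, twist_succ_odd hqa hi]
      have := homogGeomSum_mul_seq (x := xl k (n + 1) q) (ξ := twist q j • xr k (n + 1) q)
        (ξ' := (q ^ n * twist q j) • xr k (n + 1) q)
        (T := fun m => homogGeomSum ((q ^ m * twist q i) • yl k (n + 1) q) (yr k (n + 1) q) (n + 1))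
        (fun m => by rw [xl_mul_homogGeomSum, ← mul_assoc, ← pow_succ'])
        (fun m => by rw [smul_xr_mul_homogGeomSum hq, ← mul_assoc, ← pow_succ']) n
      simpa using this

/-! ### Contracting homotopies for the two directions. -/

section Homotopy

/-- The contracting homotopy in the `X` direction. -/
noncomputable def hX (ha : 1 ≤ a) (hq : q ≠ 0) (i j : ℕ) :
    EnvelopingAlgebra k (QCI k a q) →ₗ[k] EnvelopingAlgebra k (QCI k a q) :=
  if Even i then evenHomotopy (monomialBasis ha hq) (fun t => Y k a q ^ (t : ℕ)) (X k a q)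
    (twist q j • xr k a q)
  else oddHomotopy (monomialBasis ha hq) (fun t => Y k a q ^ (t : ℕ))

/-- The contracting homotopy in the `Y` direction, used at positions `(0, j)`. -/
noncomputable def hY (ha : 1 ≤ a) (hq : q ≠ 0) (j : ℕ) :
    EnvelopingAlgebra k (QCI k a q) →ₗ[k] EnvelopingAlgebra k (QCI k a q) :=
  if Even j then evenHomotopy (monomialBasis' ha hq) (fun t => X k a q ^ (t : ℕ)) (Y k a q)
    (yr k a q)
  else oddHomotopy (monomialBasis' ha hq) (fun t => X k a q ^ (t : ℕ))

lemma mul_smul_inr_mem_coeffSpan {A : Type*} [Ring A] [Algebra k A] {ι : Type*} {g : ι → A}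
    (c : k) (y : A) (m : EnvelopingAlgebra k A)
    (hm : m ∈ coeffSpan k g) : m * c • inr y ∈ coeffSpan k g := by
  rw [mul_smul_comm]
  exact Submodule.smul_mem _ _ (mul_inr_mem_coeffSpan hm y)

lemma mul_yl_mem_coeffSpan (m : EnvelopingAlgebra k (QCI k a q))
    (hm : m ∈ coeffSpan k (fun t : Fin a => Y k a q ^ (t : ℕ))) :
    m * yl k a q ∈ coeffSpan k (fun t : Fin a => Y k a q ^ (t : ℕ)) := by
  induction hm using Submodule.span_induction with
  | mem m hm =>
    obtain ⟨⟨t, c⟩, rfl⟩ := hm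
    dsimp only
    rw [mul_assoc, ← (commute_inl_inr _ _).eq, ← mul_assoc, ← inl_mul, ← pow_succ]
    by_cases h : (t : ℕ) + 1 < a
    · exact Submodule.subset_span ⟨(⟨t + 1, h⟩, c), rfl⟩
    · rw [Y_pow_eq_zero (not_lt.1 h)]
      simp [inl]
  | zero => rw [zero_mul]; exact Submodule.zero_mem _
  | add s t _ _ hs ht => rw [add_mul]; exact Submodule.add_mem _ hs ht
  | smul r s _ hs => rw [smul_mul_assoc]; exact Submodule.smul_mem _ _ hs

variable (ha : 1 ≤ a) (hq : q ≠ 0)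

lemma hX_mul_dX_add (i j : ℕ) (z : EnvelopingAlgebra k (QCI k a q)) :
    hX ha hq (i + 1) j z * dX k a q (i + 1) j + hX ha hq i j (z * dX k a q i j) = z := by
  unfold hX dX
  by_cases hi : Even i
  · rw [if_neg (by simpa [Nat.even_add_one] using hi), if_neg (by simpa [Nat.even_add_one] using hi),
      if_pos hi, if_pos hi]
    exact oddHomotopy_mul_add_evenHomotopy (fun p => monomialBasis_apply ha hq p) X_pow
      (commute_xl_smul_xr _) (mul_smul_inr_mem_coeffSpan _ _) z
  · rw [if_pos (by simpa [Nat.even_add_one] using hi), if_pos (by simpa [Nat.even_add_one] using hi),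
      if_neg hi, if_neg hi]
    exact evenHomotopy_mul_add_oddHomotopy (fun p => monomialBasis_apply ha hq p) X_pow
      (commute_xl_smul_xr _) (mul_smul_inr_mem_coeffSpan _ _) z

lemma hY_mul_dY_add (j : ℕ) (z : EnvelopingAlgebra k (QCI k a q)) :
    hY ha hq (j + 1) z * dY k a q 0 (j + 1) + hY ha hq j (z * dY k a q 0 j) = z := by
  unfold hY dY
  rw [twist_even (by simp), one_smul]
  by_cases hj : Even j
  · rw [if_neg (by simpa [Nat.even_add_one] using hj), if_neg (by simpa [Nat.even_add_one] using hj),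
      if_pos hj, if_pos hj]
    exact oddHomotopy_mul_add_evenHomotopy (fun p => monomialBasis'_apply ha hq p) Y_pow
      (commute_inl_inr _ _) (fun m hm => mul_inr_mem_coeffSpan hm _) z
  · rw [if_pos (by simpa [Nat.even_add_one] using hj), if_pos (by simpa [Nat.even_add_one] using hj),
      if_neg hj, if_neg hj]
    exact evenHomotopy_mul_add_oddHomotopy (fun p => monomialBasis'_apply ha hq p) Y_pow
      (commute_inl_inr _ _) (fun m hm => mul_inr_mem_coeffSpan hm _) z

lemma evenHomotopy_mul_yl (c d : k) (z : EnvelopingAlgebra k (QCI k a q)) :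
    evenHomotopy (monomialBasis ha hq) (fun t => Y k a q ^ (t : ℕ)) (X k a q)
      (c • xr k a q) (z * (d • yl k a q)) =
    evenHomotopy (monomialBasis ha hq) (fun t => Y k a q ^ (t : ℕ)) (X k a q)
      ((q * c) • xr k a q) z * ((q * d) • yl k a q) := by
  rw [mul_smul_comm, map_smul, mul_comm q d, mul_smul d q (yl k a q), mul_smul_comm d]
  congr 1
  refine coeffMap_mul (r := q) (fun p => monomialBasis_apply ha hq p) mul_yl_mem_coeffSpan
    xl_mul_yl (fun v _ => ?_) z
  cases v with
  | zero => simp [homogGeomSum]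
  | succ n =>
    have := homogGeomSum_mul_seq (x := xl k a q) (ξ := c • xr k a q)
      (ξ' := (q * c) • xr k a q) (T := fun m => q ^ m • yl k a q)
      (fun m => by rw [mul_smul_comm, xl_mul_yl, smul_smul, pow_succ, smul_mul_assoc])
      (fun m => by
        rw [smul_mul_smul_comm, smul_mul_smul_comm, (commute_inl_inr _ _).eq]
        congr 1; ring) n
    rw [pow_zero, one_smul] at this
    rw [mul_smul_comm, this, smul_mul_assoc, smul_smul, ← pow_succ']

lemma evenHomotopy_mul_yr (c : k) (z : EnvelopingAlgebra k (QCI k a q)) :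
    evenHomotopy (monomialBasis ha hq) (fun t => Y k a q ^ (t : ℕ)) (X k a q)
      (c • xr k a q) (z * yr k a q) =
    evenHomotopy (monomialBasis ha hq) (fun t => Y k a q ^ (t : ℕ)) (X k a q)
      ((q * c) • xr k a q) z * yr k a q := by
  refine coeffMap_mul (r := 1) (fun p => monomialBasis_apply ha hq p)
    (fun m hm => mul_inr_mem_coeffSpan hm _)
    (by rw [one_smul, (commute_inl_inr _ _).eq]) (fun v _ => ?_) z
  rw [one_pow, one_smul]
  cases v with
  | zero => simp [homogGeomSum]
  | succ n =>
    exact (homogGeomSum_mul_seq (x := xl k a q) (ξ := c • xr k a q)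
      (ξ' := (q * c) • xr k a q) (T := fun _ => yr k a q)
      (fun m => (commute_inl_inr _ _).eq)
      (fun m => by rw [smul_mul_assoc, mul_smul_comm, yr_mul_xr, smul_smul, mul_comm]) n).symm

lemma oddHomotopy_mul_yl (d : k) (z : EnvelopingAlgebra k (QCI k a q)) :
    oddHomotopy (monomialBasis ha hq) (fun t => Y k a q ^ (t : ℕ)) (z * (d • yl k a q)) =
    oddHomotopy (monomialBasis ha hq) (fun t => Y k a q ^ (t : ℕ)) z *
      ((q ^ (a - 1) * d) • yl k a q) := by
  rw [mul_smul_comm, map_smul, mul_comm _ d, mul_smul d _ (yl k a q), mul_smul_comm d]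
  congr 1
  refine coeffMap_mul (r := q) (fun p => monomialBasis_apply ha hq p) mul_yl_mem_coeffSpan
    xl_mul_yl (fun v _ => ?_) z
  split_ifs with h
  · subst h; simp
  · simp

lemma oddHomotopy_mul_yr (z : EnvelopingAlgebra k (QCI k a q)) :
    oddHomotopy (monomialBasis ha hq) (fun t => Y k a q ^ (t : ℕ)) (z * yr k a q) =
    oddHomotopy (monomialBasis ha hq) (fun t => Y k a q ^ (t : ℕ)) z * yr k a q := by
  refine coeffMap_mul (r := 1) (fun p => monomialBasis_apply ha hq p)
    (fun m hm => mul_inr_mem_coeffSpan hm _)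
    (by rw [one_smul, (commute_inl_inr _ _).eq]) (fun v _ => ?_) z
  split_ifs <;> simp

/-- The horizontal homotopy is a chain map for the vertical differential, provided the twists in
both advance together. This is what lets a row contraction be extended to the total complex. -/
lemma hX_mul_dY (hqa : q ^ a = 1) (i j : ℕ) (z : EnvelopingAlgebra k (QCI k a q)) :
    hX ha hq i j (z * dY k a q i j) = hX ha hq i (j + 1) z * dY k a q (i + 1) j := by
  unfold hX dY
  by_cases hi : Even i
  · rw [if_pos hi, if_pos hi, twist_succ_even hi]
    by_cases hj : Even j
    · rw [if_pos hj, if_pos hj, twist_succ_even hj, mul_sub, map_sub, evenHomotopy_mul_yl,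
        evenHomotopy_mul_yr, mul_sub]
    · rw [if_neg hj, if_neg hj]
      obtain ⟨n, rfl⟩ := Nat.exists_eq_add_of_le' ha
      rw [twist_succ_odd hqa hj]
      have := map_mul_homogGeomSum
        (H := fun m => evenHomotopy (monomialBasis ha hq) (fun t => Y k (n + 1) q ^ (t : ℕ))
          (X k (n + 1) q) ((q ^ m * twist q j) • xr k (n + 1) q))
        (y₁ := twist q i • yl k (n + 1) q) (y₂ := (q * twist q i) • yl k (n + 1) q)
        (η₁ := yr k (n + 1) q) (η₂ := yr k (n + 1) q)
        (fun m z => by rw [evenHomotopy_mul_yl, ← mul_assoc, ← pow_succ'])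
        (fun m z => by rw [evenHomotopy_mul_yr, ← mul_assoc, ← pow_succ']) n 0 z
      simpa using this
  · rw [if_neg hi, if_neg hi]
    obtain ⟨n, rfl⟩ := Nat.exists_eq_add_of_le' ha
    rw [twist_succ_odd hqa hi]
    by_cases hj : Even j
    · rw [if_pos hj, if_pos hj, mul_sub, map_sub, oddHomotopy_mul_yl,
        oddHomotopy_mul_yr, mul_sub, Nat.add_sub_cancel]
    · rw [if_neg hj, if_neg hj]
      exact map_mul_homogGeomSum
        (H := fun _ => oddHomotopy (monomialBasis ha hq) (fun t => Y k (n + 1) q ^ (t : ℕ)))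
        (y₁ := twist q i • yl k (n + 1) q) (y₂ := (q ^ n * twist q i) • yl k (n + 1) q)
        (η₁ := yr k (n + 1) q) (η₂ := yr k (n + 1) q)
        (fun m z => by rw [oddHomotopy_mul_yl, Nat.add_sub_cancel])
        (fun m z => oddHomotopy_mul_yr ha hq z) n 0 z

/-- Collapsing both directions at the origin factors through the action on the unit. -/
lemma eq_add_of_origin (z : EnvelopingAlgebra k (QCI k a q))
    (hz : AlgHom.mulLeftRight k (QCI k a q) z 1 = 0) :
    z = hX ha hq 0 0 z * dX k a q 0 0 +
      hY ha hq 0 (z - hX ha hq 0 0 z * dX k a q 0 0) * dY k a q 0 0 := by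
  suffices h : ∀ z, z = hX ha hq 0 0 z * dX k a q 0 0 +
      hY ha hq 0 (z - hX ha hq 0 0 z * dX k a q 0 0) * dY k a q 0 0 +
      inr (AlgHom.mulLeftRight k (QCI k a q) z 1) by
    have h' := h z
    rw [hz] at h'
    simpa [inr] using h'
  intro z
  -- `P` replaces left multiplication by `X` with right multiplication, and `Q` does the same for
  -- `Y`. Together they move the whole left factor to the right.
  let P : EnvelopingAlgebra k (QCI k a q) →ₗ[k] EnvelopingAlgebra k (QCI k a q) :=
    LinearMap.id - LinearMap.mulRight k (dX k a q 0 0) ∘ₗ hX ha hq 0 0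
  let Q : EnvelopingAlgebra k (QCI k a q) →ₗ[k] EnvelopingAlgebra k (QCI k a q) :=
    LinearMap.id - LinearMap.mulRight k (dY k a q 0 0) ∘ₗ hY ha hq 0
  let ε : EnvelopingAlgebra k (QCI k a q) →ₗ[k] EnvelopingAlgebra k (QCI k a q) :=
    TensorProduct.mk k (QCI k a q) (QCI k a q)ᵐᵒᵖ 1 ∘ₗ
      (opLinearEquiv k : QCI k a q ≃ₗ[k] (QCI k a q)ᵐᵒᵖ).toLinearMap ∘ₗ
      LinearMap.applyₗ (1 : QCI k a q) ∘ₗ (AlgHom.mulLeftRight k (QCI k a q)).toLinearMap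
  suffices h : Q ∘ₗ P = ε by
    have h' := LinearMap.congr_fun h z
    have e : ε z = inr (AlgHom.mulLeftRight k (QCI k a q) z 1) := rfl
    rw [← e, ← h']
    simp only [P, Q, LinearMap.comp_apply, LinearMap.sub_apply, LinearMap.id_apply,
      LinearMap.mulRight_apply]
    abel
  have hd : dX k a q 0 0 = xl k a q - xr k a q := by simp [dX, twist]
  have hd' : dY k a q 0 0 = yl k a q - yr k a q := by simp [dY, twist]
  have hP : ∀ m ∈ coeffSpan k (fun t : Fin a => Y k a q ^ (t : ℕ)), ∀ v < a,
      P (m * xl k a q ^ v) = m * xr k a q ^ v := by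
    intro m hm v hv
    have := sub_evenHomotopy_mul (fun p => monomialBasis_apply ha hq p)
      (commute_inl_inr (X k a q) (X k a q)) hm hv
    rw [← this]
    simp [P, hd, hX, twist]
  have hQ : ∀ m ∈ coeffSpan k (fun t : Fin a => X k a q ^ (t : ℕ)), ∀ v < a,
      Q (m * yl k a q ^ v) = m * yr k a q ^ v := by
    intro m hm v hv
    have := sub_evenHomotopy_mul (fun p => monomialBasis'_apply ha hq p)
      (commute_inl_inr (Y k a q) (Y k a q)) hm hv
    rw [← this]
    simp [Q, hd', hY]
  apply TensorProduct.ext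
  refine (monomialBasis ha hq).ext fun p => ?_
  refine LinearMap.ext fun c => ?_
  obtain ⟨c, rfl⟩ := op_surjective c
  have e : monomialBasis ha hq p ⊗ₜ[k] op c =
      inl (k := k) (Y k a q ^ (p.1 : ℕ)) * inr c * xl k a q ^ (p.2 : ℕ) := by
    rw [monomialBasis_apply, mul_assoc, ← inl_pow, ← (commute_inl_inr _ _).eq, ← mul_assoc,
      ← inl_mul, inl_mul_inr]
  -- After `P` no `X` is left on the left side, so the element has coefficient `X ^ 0` in the basis
  -- `X ^ v Y ^ u` used by `Q`.
  have e' : inl (k := k) (Y k a q ^ (p.1 : ℕ)) * inr c * xr k a q ^ (p.2 : ℕ) =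
      inl (X k a q ^ 0) * inr (X k a q ^ (p.2 : ℕ) * c) * yl k a q ^ (p.1 : ℕ) := by
    rw [pow_zero, show inl (1 : QCI k a q) = (1 : EnvelopingAlgebra k (QCI k a q)) from rfl, one_mul,
      ← inl_pow, ← (commute_inl_inr _ _).eq, inr_mul, inr_pow, mul_assoc]
  have h1 : (Q ∘ₗ P) (monomialBasis ha hq p ⊗ₜ[k] op c) =
      inr (Y k a q ^ (p.1 : ℕ) * (X k a q ^ (p.2 : ℕ) * c)) := by
    rw [LinearMap.comp_apply, e, hP _ (Submodule.subset_span ⟨(p.1, c), rfl⟩) _ p.2.2, e',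
      hQ _ (Submodule.subset_span ⟨(⟨0, ha⟩, X k a q ^ (p.2 : ℕ) * c), rfl⟩) _ p.1.2, inr_mul,
      inr_pow (Y k a q)]
    dsimp only
    rw [pow_zero,
      show inl (1 : QCI k a q) = (1 : EnvelopingAlgebra k (QCI k a q)) from rfl, one_mul]
  have h2 : ε (monomialBasis ha hq p ⊗ₜ[k] op c) =
      inr (Y k a q ^ (p.1 : ℕ) * (X k a q ^ (p.2 : ℕ) * c)) := by
    change inr (AlgHom.mulLeftRight k (QCI k a q) (monomialBasis ha hq p ⊗ₜ[k] op c) 1) = _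
    rw [AlgHom.mulLeftRight_apply, monomialBasis_apply, mul_one, unop_op, mul_assoc]
  exact h1.trans h2.symm

end Homotopy

end QCI

/-! ### Exactness of the total complex. -/

section Total

variable {R : Type*} [Ring R]

/-- The differential of the total complex of a double complex of free modules of rank one. -/
def totalD (dX dY : ℕ → ℕ → R) (n : ℕ) : (Fin (n + 2) → R) →ₗ[R] (Fin (n + 1) → R) where
  toFun z i := z i.succ * dX i (n - i) + z i.castSucc * ((-1) ^ (i : ℕ) * dY i (n - i))
  map_add' z w := by ext i; simp only [Pi.add_apply, add_mul]; abel
  map_smul' r z := by ext i; simp [mul_add, mul_assoc]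

variable {dX dY : ℕ → ℕ → R}

lemma totalD_apply (n : ℕ) (z : Fin (n + 2) → R) (i : Fin (n + 1)) :
    totalD dX dY n z i =
      z i.succ * dX i (n - i) + z i.castSucc * ((-1) ^ (i : ℕ) * dY i (n - i)) := rfl

lemma totalD_comp (hXX : ∀ i j, dX (i + 1) j * dX i j = 0) (hYY : ∀ i j, dY i (j + 1) * dY i j = 0)
    (hXY : ∀ i j, dX i (j + 1) * dY i j = dY (i + 1) j * dX i j) (n : ℕ)
    (z : Fin (n + 3) → R) : totalD dX dY n (totalD dX dY (n + 1) z) = 0 := by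
  ext i
  have e : n + 1 - (i : ℕ) = n - i + 1 := by omega
  simp only [totalD_apply, Fin.val_succ, Fin.val_castSucc, Nat.add_sub_add_right, e, Pi.zero_apply]
  rw [← Fin.castSucc_succ]
  rcases neg_one_pow_eq_or R (i : ℕ) with h | h <;>
  simp [pow_succ, h, add_mul, mul_assoc, hXX, hYY, hXY]

variable {hX : ℕ → ℕ → R →+ R} {hY : ℕ → R →+ R}

/-- Each row is contracted by `hX` except for a remainder in column `0`. That remainder is a
vertical cycle, so `hY` contracts it. -/
lemma exists_totalD_eq (hXX : ∀ i j, dX (i + 1) j * dX i j = 0)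
    (hXY : ∀ i j, dX i (j + 1) * dY i j = dY (i + 1) j * dX i j)
    (homX : ∀ i j z, hX (i + 1) j z * dX (i + 1) j + hX i j (z * dX i j) = z)
    (homXY : ∀ i j z, hX i j (z * dY i j) = hX i (j + 1) z * dY (i + 1) j)
    (homY : ∀ j z, hY (j + 1) z * dY 0 (j + 1) + hY j (z * dY 0 j) = z) (n : ℕ)
    (z : Fin (n + 2) → R) (hz : totalD dX dY n z = 0) : ∃ w, totalD dX dY (n + 1) w = z := by
  refine ⟨Fin.cons (hY (n + 1) (z 0 - hX 0 (n + 1) (z 0) * dX 0 (n + 1)))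
    (fun i => hX i (n + 1 - i) (z i)), ?_⟩
  have hz' : ∀ i : Fin (n + 1), z i.succ * dX i (n - i) =
      - (z i.castSucc * ((-1) ^ (i : ℕ) * dY i (n - i))) := fun i =>
    eq_neg_of_add_eq_zero_left (congrFun hz i)
  have hs : ∀ (m : ℕ) (r : R), (-1 : R) ^ m * r = r * (-1) ^ m := fun m r =>
    ((Commute.neg_one_left r).pow_left m).eq
  have hsm : ∀ (f : R →+ R) (m : ℕ) (r : R), f (r * (-1) ^ m) = f r * (-1) ^ m := by
    intro f m r
    rcases neg_one_pow_eq_or R m with h | h <;> simp [h]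
  ext i
  rw [totalD_apply]
  cases i using Fin.cases with
  | zero =>
    simp only [Fin.cons_succ, Fin.castSucc_zero, Fin.cons_zero, Fin.val_zero, pow_zero, one_mul,
      Nat.sub_zero]
    have h0 := hz' 0
    simp only [Fin.val_zero, pow_zero, one_mul, Nat.sub_zero, Fin.castSucc_zero] at h0
    -- The cycle condition makes `z 0 * dY 0 n` a horizontal boundary, and the row projection kills
    -- boundaries.
    have hp : (z 0 - hX 0 (n + 1) (z 0) * dX 0 (n + 1)) * dY 0 n = 0 := by
      have h1 := homX 0 n (z (Fin.succ 0))
      have h2 : hX 0 n (z (Fin.succ 0) * dX 0 n) * dX 0 n = z (Fin.succ 0) * dX 0 n := by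
        conv_rhs => rw [← h1]
        rw [add_mul, mul_assoc, hXX, mul_zero, zero_add]
      rw [h0, map_neg, homXY, neg_mul, neg_inj, mul_assoc, ← hXY, ← mul_assoc] at h2
      rw [sub_mul, h2, sub_self]
    have h3 := homY n (z 0 - hX 0 (n + 1) (z 0) * dX 0 (n + 1))
    rw [hp, map_zero, add_zero] at h3
    rw [h3]
    abel
  | succ i =>
    have e : n + 1 - (i : ℕ) = n - i + 1 := by omega
    have e' : (Fin.castSucc i.succ : Fin (n + 1 + 2)) = Fin.succ i.castSucc := rfl
    simp only [e', Fin.cons_succ, Fin.val_succ, Nat.add_sub_add_right, Fin.val_castSucc, e]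
    have h1 := homX i (n - i) (z i.succ)
    rw [hz' i, hs, ← mul_assoc, map_neg, hsm, homXY] at h1
    conv_rhs => rw [← h1]
    rw [hs (i + 1), pow_succ]
    simp [mul_assoc]

lemma exists_totalD_zero_eq {z : Fin 1 → R}
    (hz : z 0 = hX 0 0 (z 0) * dX 0 0 + hY 0 (z 0 - hX 0 0 (z 0) * dX 0 0) * dY 0 0) :
    ∃ w, totalD dX dY 0 w = z := by
  refine ⟨![hY 0 (z 0 - hX 0 0 (z 0) * dX 0 0), hX 0 0 (z 0)], ?_⟩
  ext i
  fin_cases i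
  rw [totalD_apply]
  simpa using hz.symm

end Total

/-! ### Acyclic double complexes with one-dimensional entries. -/

section Cohomology

/-- Shift of a sequence by one step, with `0` in position `0`. -/
def seqShift {M : Type*} [Zero M] (f : ℕ → M) : ℕ → M
  | 0 => 0
  | i + 1 => f i

lemma seqShift_zero {M : Type*} [Zero M] (f : ℕ → M) : seqShift f 0 = 0 := rfl

lemma seqShift_succ {M : Type*} [Zero M] (f : ℕ → M) (i : ℕ) : seqShift f (i + 1) = f i := rfl

/-- The total differential of a double complex of abelian groups with constant entries. -/
def totalDelta {M : Type*} [AddCommGroup M] (fX fY : ℕ → ℕ → M → M) (φ : ℕ → ℕ → M) (i j : ℕ) : M :=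
  seqShift (fun i => fX i j (φ i j)) i + (-1 : ℤ) ^ i • seqShift (fun j => fY i j (φ i j)) j

variable {k : Type*} [Field k] {α β : ℕ → ℕ → k}

/-- A double complex with one-dimensional entries whose even horizontal differentials are
invertible is acyclic. -/
lemma exists_totalDelta_eq_of_horizontal (hα : ∀ i j, Even i → α i j ≠ 0)
    (h : ∀ i j, β i j * α i (j + 1) = α i j * β (i + 1) j) (φ : ℕ → ℕ → k) (n : ℕ)
    (hφ : ∀ i j, i + j = n + 1 →
      totalDelta (fun i j => (α i j * ·)) (fun i j => (β i j * ·)) φ i j = 0) :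
    ∃ ψ : ℕ → ℕ → k, ∀ i j, i + j = n →
      totalDelta (fun i j => (α i j * ·)) (fun i j => (β i j * ·)) ψ i j = φ i j := by
  -- Inverting `α` in even columns hits the odd columns of `φ` exactly. The even columns then agree
  -- by the cocycle condition one column to the right, where `α i j` can be cancelled; the odd `α`
  -- play no role.
  refine ⟨fun i j => if Even i then (α i j)⁻¹ * φ (i + 1) j else 0, fun i j hij => ?_⟩
  by_cases hi : Even i
  · have h1 := hφ (i + 1) j (by omega)
    have hX : seqShift
        (fun i => α i j * (if Even i then (α i j)⁻¹ * φ (i + 1) j else 0)) i = 0 := by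
      cases i with
      | zero => rfl
      | succ i =>
        rw [Nat.even_add_one] at hi
        simp [seqShift_succ, hi]
    have h0 := hα i j hi
    simp only [totalDelta, seqShift_succ] at h1 ⊢
    rw [hX, hi.neg_one_pow]
    rw [(hi.add_one).neg_one_pow] at h1
    cases j with
    | zero =>
      simp only [seqShift_zero, smul_zero, add_zero, mul_eq_zero, h0, false_or] at h1
      simp [h1, seqShift_zero]
    | succ j =>
      have h2 := hα i j hi
      have h3 := h i j
      simp only [seqShift_succ, neg_smul, one_smul, zero_add, if_pos hi] at h1 ⊢
      field_simp
      have : α i (j + 1) * (β i j * φ (i + 1) j) = α i (j + 1) * (α i j * φ i (j + 1)) := by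
        linear_combination φ (i + 1) j * h3 - α i j * h1
      exact mul_left_cancel₀ h0 this
  · obtain ⟨i, rfl⟩ : ∃ m, i = m + 1 := Nat.exists_eq_succ_of_ne_zero (by rintro rfl; simp at hi)
    have hi' : Even i := by simpa [Nat.even_add_one] using hi
    have h0 := hα i j hi'
    simp only [totalDelta, seqShift_succ, if_pos hi', if_neg hi]
    cases j <;> simp [h0, seqShift_zero, seqShift_succ]

/-- A double complex with one-dimensional entries whose even vertical differentials are
invertible is acyclic. -/
lemma exists_totalDelta_eq_of_vertical (hβ : ∀ i j, Even j → β i j ≠ 0)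
    (h : ∀ i j, β i j * α i (j + 1) = α i j * β (i + 1) j) (φ : ℕ → ℕ → k) (n : ℕ)
    (hφ : ∀ i j, i + j = n + 1 →
      totalDelta (fun i j => (α i j * ·)) (fun i j => (β i j * ·)) φ i j = 0) :
    ∃ ψ : ℕ → ℕ → k, ∀ i j, i + j = n →
      totalDelta (fun i j => (α i j * ·)) (fun i j => (β i j * ·)) ψ i j = φ i j := by
  -- The factor `(-1) ^ i` cancels the sign carried by the vertical differential.
  refine ⟨fun i j => if Even j then (-1) ^ i * ((β i j)⁻¹ * φ i (j + 1)) else 0,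
    fun i j hij => ?_⟩
  have hs : ∀ i : ℕ, ((-1 : k) ^ i) * (-1) ^ i = 1 := fun i => by
    rw [← mul_pow]; simp
  by_cases hj : Even j
  · have h1 := hφ i (j + 1) (by omega)
    have hY : seqShift
        (fun j => β i j * (if Even j then (-1) ^ i * ((β i j)⁻¹ * φ i (j + 1)) else 0)) j = 0 := by
      cases j with
      | zero => rfl
      | succ j =>
        rw [Nat.even_add_one] at hj
        simp [seqShift_succ, hj]
    have h0 := hβ i j hj
    simp only [totalDelta, seqShift_succ] at h1 ⊢
    rw [hY]
    cases i with
    | zero =>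
      have h2 : φ 0 j = 0 := by simpa [h0, seqShift_zero] using h1
      simp [seqShift_zero, h2]
    | succ i =>
      have h2 := hβ i j hj
      have h3 := h i j
      simp only [seqShift_succ, smul_zero, add_zero, if_pos hj, zsmul_eq_mul, Int.cast_pow, Int.cast_neg,
        Int.cast_one] at h1 ⊢
      field_simp
      have : β (i + 1) j * (α i j * (-1) ^ i * φ i (j + 1)) =
          β (i + 1) j * (β i j * φ (i + 1) j) := by
        linear_combination (-1) ^ i * β i j * h1 - (-1) ^ i * φ i (j + 1) * h3 +
          β i j * β (i + 1) j * φ (i + 1) j * hs i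
      exact mul_left_cancel₀ h0 this
  · obtain ⟨j, rfl⟩ : ∃ m, j = m + 1 := Nat.exists_eq_succ_of_ne_zero (by rintro rfl; simp at hj)
    have hj' : Even j := by simpa [Nat.even_add_one] using hj
    have h0 := hβ i j hj'
    simp only [totalDelta, seqShift_succ, if_pos hj', if_neg hj, zsmul_eq_mul, Int.cast_pow, Int.cast_neg,
        Int.cast_one]
    have : ∀ x : k, (-1) ^ i * (β i j * ((-1) ^ i * ((β i j)⁻¹ * x))) = x := fun x => by
      rw [mul_left_comm (β i j), ← mul_assoc, hs, mul_inv_cancel_left₀ h0, one_mul]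
    cases i with
    | zero => simp [h0, seqShift_zero]
    | succ i => simp only [seqShift_succ, mul_zero, zero_add, this]

end Cohomology

lemma homogGeomSum_apply_seq {k M : Type*} [Field k] [AddCommGroup M] [Module k M]
    {S T : Module.End k M} {e : ℕ → M} {r t : k} (hS : ∀ n, S (e n) = r • e (n + 1))
    (hT : ∀ n, T (e n) = t • e (n + 1)) (n m : ℕ) :
    homogGeomSum S T (n + 1) (e m) = homogGeomSum r t (n + 1) • e (m + n) := by
  have hpow : ∀ n m, (S ^ n) (e m) = r ^ n • e (m + n) := by
    intro n
    induction n with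
    | zero => simp
    | succ n ih =>
      intro m
      rw [pow_succ', Module.End.mul_apply, ih, map_smul, hS, smul_smul, pow_succ, add_assoc]
  induction n with
  | zero => simp [homogGeomSum]
  | succ n ih =>
    rw [homogGeomSum_succ, LinearMap.add_apply, hpow, Module.End.mul_apply, ih, map_smul, hT,
      homogGeomSum_succ r t (n + 1), add_smul, smul_smul, mul_comm t, add_assoc]

lemma map_homogGeomSum {R S F : Type*} [Ring R] [Ring S] [FunLike F R S] [RingHomClass F R S]
    (f : F) (x ξ : R) (n : ℕ) : f (homogGeomSum x ξ n) = homogGeomSum (f x) (f ξ) n := by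
  induction n with
  | zero => exact map_zero f
  | succ n ih => rw [homogGeomSum_succ, homogGeomSum_succ, map_add, map_mul, map_pow, ih]

/-! ### The differentials on `A` in monomial coordinates. -/

namespace QCI

open EnvelopingAlgebra

variable {k : Type*} [Field k] {a : ℕ} {q : k}

variable (k a q) in
/-- The action of the enveloping algebra on the algebra. -/
noncomputable abbrev act : EnvelopingAlgebra k (QCI k a q) →ₐ[k] Module.End k (QCI k a q) :=
  AlgHom.mulLeftRight k (QCI k a q)

lemma act_xl (u v : ℕ) : act k a q (xl k a q) (Y k a q ^ u * X k a q ^ v) =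
    q ^ u • (Y k a q ^ u * X k a q ^ (v + 1)) := by
  rw [xl, inl, AlgHom.mulLeftRight_apply, unop_one, mul_one, ← mul_assoc, X_mul_Y_pow, smul_mul_assoc,
    mul_assoc, ← pow_succ']

lemma act_xr (u v : ℕ) : act k a q (xr k a q) (Y k a q ^ u * X k a q ^ v) =
    Y k a q ^ u * X k a q ^ (v + 1) := by
  rw [xr, inr, AlgHom.mulLeftRight_apply, unop_op, one_mul, mul_assoc, ← pow_succ]

lemma act_yl (u v : ℕ) : act k a q (yl k a q) (Y k a q ^ u * X k a q ^ v) =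
    Y k a q ^ (u + 1) * X k a q ^ v := by
  rw [yl, inl, AlgHom.mulLeftRight_apply, unop_one, mul_one, ← mul_assoc, ← pow_succ']

lemma act_yr (u v : ℕ) : act k a q (yr k a q) (Y k a q ^ u * X k a q ^ v) =
    q ^ v • (Y k a q ^ (u + 1) * X k a q ^ v) := by
  rw [yr, inr, AlgHom.mulLeftRight_apply, unop_op, one_mul, mul_assoc, X_pow_mul_Y, mul_smul_comm,
    ← mul_assoc, ← pow_succ]

lemma act_smul_xr (c : k) (u v : ℕ) : act k a q (c • xr k a q) (Y k a q ^ u * X k a q ^ v) =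
    c • (Y k a q ^ u * X k a q ^ (v + 1)) := by
  rw [map_smul, LinearMap.smul_apply, act_xr]

lemma act_smul_yl (c : k) (u v : ℕ) : act k a q (c • yl k a q) (Y k a q ^ u * X k a q ^ v) =
    c • (Y k a q ^ (u + 1) * X k a q ^ v) := by
  rw [map_smul, LinearMap.smul_apply, act_yl]

lemma act_dX_even {i : ℕ} (hi : Even i) (j u v : ℕ) :
    act k a q (dX k a q i j) (Y k a q ^ u * X k a q ^ v) =
      (q ^ u - twist q j) • (Y k a q ^ u * X k a q ^ (v + 1)) := by
  rw [dX, if_pos hi, map_sub, LinearMap.sub_apply, act_xl, act_smul_xr]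
  exact (sub_smul (q ^ u) (twist q j) (Y k a q ^ u * X k a q ^ (v + 1))).symm

lemma act_dX_odd {n : ℕ} {i : ℕ} (hi : ¬ Even i) (j u v : ℕ) :
    act k (n + 1) q (dX k (n + 1) q i j) (Y k (n + 1) q ^ u * X k (n + 1) q ^ v) =
      homogGeomSum (q ^ u) (twist q j) (n + 1) •
        (Y k (n + 1) q ^ u * X k (n + 1) q ^ (v + n)) := by
  rw [dX, if_neg hi, map_homogGeomSum]
  exact homogGeomSum_apply_seq (e := fun v => Y k (n + 1) q ^ u * X k (n + 1) q ^ v)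
    (fun v => act_xl u v) (fun v => act_smul_xr _ u v) n v

lemma act_dY_even {j : ℕ} (hj : Even j) (i u v : ℕ) :
    act k a q (dY k a q i j) (Y k a q ^ u * X k a q ^ v) =
      (twist q i - q ^ v) • (Y k a q ^ (u + 1) * X k a q ^ v) := by
  rw [dY, if_pos hj, map_sub, LinearMap.sub_apply, act_yr, act_smul_yl]
  exact (sub_smul (twist q i) (q ^ v) (Y k a q ^ (u + 1) * X k a q ^ v)).symm

lemma act_dY_odd {n : ℕ} {j : ℕ} (hj : ¬ Even j) (i u v : ℕ) :
    act k (n + 1) q (dY k (n + 1) q i j) (Y k (n + 1) q ^ u * X k (n + 1) q ^ v) =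
      homogGeomSum (twist q i) (q ^ v) (n + 1) •
        (Y k (n + 1) q ^ (u + n) * X k (n + 1) q ^ v) := by
  rw [dY, if_neg hj, map_homogGeomSum]
  exact homogGeomSum_apply_seq (e := fun u => Y k (n + 1) q ^ u * X k (n + 1) q ^ v)
    (fun u => act_smul_yl _ u v) (fun u => act_yr u v) n u

section Coordinates

variable {m : ℕ}

/-- The parity of a degree, as an exponent. -/
def parity (m i : ℕ) : Fin (m + 2) := if Even i then 0 else 1

lemma parity_even {i : ℕ} (hi : Even i) : parity m i = 0 := if_pos hi
lemma parity_odd {i : ℕ} (hi : ¬ Even i) : parity m i = 1 := if_neg hi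

/-- The basis of monomials, with exponents shifted according to the parities of the degrees. -/
noncomputable def shiftedBasis (hq : q ≠ 0) (i j : ℕ) :
    Module.Basis (Fin (m + 2) × Fin (m + 2)) k (QCI k (m + 2) q) :=
  (monomialBasis (by omega) hq).reindex
    ((Equiv.addRight (parity m j)).prodCongr (Equiv.addRight (parity m i))).symm

lemma shiftedBasis_apply (hq : q ≠ 0) (i j : ℕ) (w z : Fin (m + 2)) :
    shiftedBasis hq i j (w, z) = Y k (m + 2) q ^ ((w + parity m j : Fin (m + 2)) : ℕ) *
      X k (m + 2) q ^ ((z + parity m i : Fin (m + 2)) : ℕ) := by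
  simp [shiftedBasis, monomialBasis_apply]

/-- The scalar by which the horizontal differential acts on the shifted bases. -/
def coefX (q : k) (i j : ℕ) (p : Fin (m + 2) × Fin (m + 2)) : k :=
  if Even i then (if p.2 = Fin.last (m + 1) then 0
    else q ^ ((p.1 + parity m j : Fin (m + 2)) : ℕ) - twist q j)
  else (if p.2 = Fin.last (m + 1) then
    homogGeomSum (q ^ ((p.1 + parity m j : Fin (m + 2)) : ℕ)) (twist q j) (m + 2) else 0)

/-- The scalar by which the vertical differential acts on the shifted bases. -/
def coefY (q : k) (i j : ℕ) (p : Fin (m + 2) × Fin (m + 2)) : k :=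
  if Even j then (if p.1 = Fin.last (m + 1) then 0
    else twist q i - q ^ ((p.2 + parity m i : Fin (m + 2)) : ℕ))
  else (if p.1 = Fin.last (m + 1) then
    homogGeomSum (twist q i) (q ^ ((p.2 + parity m i : Fin (m + 2)) : ℕ)) (m + 2) else 0)

lemma val_add_one {z : Fin (m + 2)} (hz : z ≠ Fin.last (m + 1)) :
    ((z + 1 : Fin (m + 2)) : ℕ) = z + 1 := Fin.val_add_one_of_lt (Fin.lt_last_iff_ne_last.2 hz)

/-- For even `i` the differential raises the exponent of `X` by one; for odd `i` it raises it by `a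
- 1`, that is, lowers it by one modulo `a`. The parity shift compensates for both, so the label `p`
is preserved. Truncation allows a nonzero odd map only at exponent `0`, whose label is `Fin.last`.
-/
lemma act_dX_shiftedBasis (hq : q ≠ 0) (i j : ℕ) (p : Fin (m + 2) × Fin (m + 2)) :
    act k (m + 2) q (dX k (m + 2) q i j) (shiftedBasis hq i j p) =
      coefX q i j p • shiftedBasis hq (i + 1) j p := by
  obtain ⟨w, z⟩ := p
  rw [shiftedBasis_apply, shiftedBasis_apply, coefX]
  by_cases hi : Even i
  · have hi' : ¬ Even (i + 1) := by simpa [Nat.even_add_one] using hi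
    rw [parity_even hi, parity_odd hi', if_pos hi, act_dX_even hi, add_zero]
    by_cases hz : z = Fin.last (m + 1)
    · rw [X_pow_eq_zero (v := (z : ℕ) + 1) (by rw [hz]; simp), if_pos hz, mul_zero, smul_zero,
        zero_smul]
    · rw [if_neg hz, val_add_one hz]
  · have hi' : Even (i + 1) := by simpa [Nat.even_add_one] using hi
    rw [parity_odd hi, parity_even hi', if_neg hi, act_dX_odd hi, add_zero]
    by_cases hz : z = Fin.last (m + 1)
    · subst hz
      rw [if_pos rfl, Fin.last_add_one, Fin.val_zero, Fin.val_last, zero_add]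
    · rw [if_neg hz, val_add_one hz, X_pow_eq_zero (by omega), mul_zero, smul_zero, zero_smul]

lemma act_dY_shiftedBasis (hq : q ≠ 0) (i j : ℕ) (p : Fin (m + 2) × Fin (m + 2)) :
    act k (m + 2) q (dY k (m + 2) q i j) (shiftedBasis hq i j p) =
      coefY q i j p • shiftedBasis hq i (j + 1) p := by
  obtain ⟨w, z⟩ := p
  rw [shiftedBasis_apply, shiftedBasis_apply, coefY]
  by_cases hj : Even j
  · have hj' : ¬ Even (j + 1) := by simpa [Nat.even_add_one] using hj
    rw [parity_even hj, parity_odd hj', if_pos hj, act_dY_even hj, add_zero]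
    by_cases hw : w = Fin.last (m + 1)
    · rw [Y_pow_eq_zero (u := (w : ℕ) + 1) (by rw [hw]; simp), if_pos hw, zero_mul, smul_zero,
        zero_smul]
    · rw [if_neg hw, val_add_one hw]
  · have hj' : Even (j + 1) := by simpa [Nat.even_add_one] using hj
    rw [parity_odd hj, parity_even hj', if_neg hj, act_dY_odd hj, add_zero]
    by_cases hw : w = Fin.last (m + 1)
    · subst hw
      rw [if_pos rfl, Fin.last_add_one, Fin.val_zero, Fin.val_last, zero_add]
    · rw [if_neg hw, val_add_one hw, Y_pow_eq_zero (by omega), zero_mul, smul_zero, zero_smul]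

/-- Read off from `dX_mul_dY` by acting on a basis vector, which avoids computing with the
coefficients. -/
lemma coefY_mul_coefX (hqa : q ^ (m + 2) = 1) (i j : ℕ) (p : Fin (m + 2) × Fin (m + 2)) :
    coefY q i j p * coefX q i (j + 1) p = coefX q i j p * coefY q (i + 1) j p := by
  have hq : q ≠ 0 := by rintro rfl; simp at hqa
  have h := congrArg (fun d => act k (m + 2) q d (shiftedBasis hq i j p))
    (dX_mul_dY (by omega) hqa i j)
  simp only [map_mul, Module.End.mul_apply, act_dX_shiftedBasis, act_dY_shiftedBasis, map_smul,
    smul_smul] at h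
  exact smul_left_injective k ((shiftedBasis hq (i + 1) (j + 1)).ne_zero p) h

/-- The parity shift of the exponent matches the twist, so off the truncation the even coefficients
are `± twist * (q ^ w - 1)` and vanish only for `w = 0`. -/
lemma pow_add_parity (hqa : q ^ (m + 2) = 1) (j : ℕ) (w : Fin (m + 2)) :
    q ^ ((w + parity m j : Fin (m + 2)) : ℕ) = twist q j * q ^ (w : ℕ) := by
  by_cases hj : Even j
  · rw [parity_even hj, twist_even hj, add_zero, one_mul]
  · rw [parity_odd hj, twist_odd hj, Fin.val_add, ← pow_eq_pow_mod _ hqa, pow_add, Fin.val_one,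
      pow_one, mul_comm]

lemma pow_val_ne_one (hq : IsPrimitiveRoot q (m + 2)) {w : Fin (m + 2)} (hw : w ≠ 0) :
    q ^ (w : ℕ) ≠ 1 :=
  hq.pow_ne_one_of_pos_of_lt (fun h => hw (Fin.ext h)) w.2

lemma twist_ne_zero (hq : q ≠ 0) (j : ℕ) : twist q j ≠ 0 := by
  unfold twist; split_ifs <;> simp [hq]

lemma pow_add_parity_ne (hq : IsPrimitiveRoot q (m + 2)) (j : ℕ) {w : Fin (m + 2)} (hw : w ≠ 0) :
    q ^ ((w + parity m j : Fin (m + 2)) : ℕ) ≠ twist q j := by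
  rw [pow_add_parity hq.pow_eq_one]
  intro h
  exact pow_val_ne_one hq hw (mul_left_cancel₀ (twist_ne_zero (hq.ne_zero (by omega)) j)
    (h.trans (mul_one _).symm))

lemma coefX_ne_zero (hq : IsPrimitiveRoot q (m + 2)) {p : Fin (m + 2) × Fin (m + 2)}
    (h1 : p.1 ≠ 0) (h2 : p.2 ≠ Fin.last (m + 1)) {i : ℕ} (hi : Even i) (j : ℕ) :
    coefX q i j p ≠ 0 := by
  rw [coefX, if_pos hi, if_neg h2]
  exact sub_ne_zero.2 (pow_add_parity_ne hq j h1)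

lemma coefY_ne_zero (hq : IsPrimitiveRoot q (m + 2)) {p : Fin (m + 2) × Fin (m + 2)}
    (h1 : p.1 ≠ Fin.last (m + 1)) (h2 : p.2 ≠ 0) (i : ℕ) {j : ℕ} (hj : Even j) :
    coefY q i j p ≠ 0 := by
  rw [coefY, if_pos hj, if_neg h1]
  exact sub_ne_zero.2 (pow_add_parity_ne hq i h2).symm

/-- Multiplied by `r - t ≠ 0`, the sum becomes `r ^ n - t ^ n = 0`. -/
lemma homogGeomSum_eq_zero {r t : k} (h : r ≠ t) {n : ℕ} (hr : r ^ n = 1) (ht : t ^ n = 1) :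
    homogGeomSum r t n = 0 := by
  have := homogGeomSum_mul_sub (Commute.all r t) n
  rw [hr, ht, sub_self] at this
  exact (mul_eq_zero.1 this).resolve_right (sub_ne_zero.2 h)

lemma pow_pow_eq_one {n : ℕ} (hqa : q ^ n = 1) (u : ℕ) : (q ^ u) ^ n = 1 := by
  rw [← pow_mul, mul_comm, pow_mul, hqa, one_pow]

/-- The two bidegrees contributing to Hochschild cohomology. -/
def survivor (m : ℕ) (s : Fin 2) : Fin (m + 2) × Fin (m + 2) :=
  if s = 0 then (0, 0) else (Fin.last (m + 1), Fin.last (m + 1))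

lemma survivor_injective : Function.Injective (survivor m) := by
  intro s t h
  fin_cases s <;> fin_cases t <;> simp_all [survivor, Fin.ext_iff]

/-- At `(0, 0)` the even coefficient contains `q ^ 0 - 1`, and the odd one is truncated. At the top
bidegree the even one is truncated, and the odd one is a norm of two distinct `a`-th roots of unity.
-/
lemma coefX_survivor (hq : IsPrimitiveRoot q (m + 2)) (i j : ℕ) (s : Fin 2) :
    coefX q i j (survivor m s) = 0 := by
  have hl : Fin.last (m + 1) ≠ 0 := by simp [Fin.ext_iff]
  unfold coefX survivor
  by_cases hs : s = 0
  · simp only [if_pos hs, hl.symm, if_false]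
    rw [pow_add_parity hq.pow_eq_one]
    simp
  · simp only [if_neg hs, if_true]
    rw [homogGeomSum_eq_zero (pow_add_parity_ne hq j hl) (pow_pow_eq_one hq.pow_eq_one _)
      (twist_pow hq.pow_eq_one j), ite_self]

lemma coefY_survivor (hq : IsPrimitiveRoot q (m + 2)) (i j : ℕ) (s : Fin 2) :
    coefY q i j (survivor m s) = 0 := by
  have hl : Fin.last (m + 1) ≠ 0 := by simp [Fin.ext_iff]
  unfold coefY survivor
  by_cases hs : s = 0
  · simp only [if_pos hs, hl.symm, if_false]
    rw [pow_add_parity hq.pow_eq_one]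
    simp
  · simp only [if_neg hs, if_true]
    rw [homogGeomSum_eq_zero (pow_add_parity_ne hq i hl).symm (twist_pow hq.pow_eq_one i)
      (pow_pow_eq_one hq.pow_eq_one _), ite_self]

/-- The bicomplex attached to a bidegree is acyclic outside of the surviving bidegrees. -/
lemma exists_totalDelta_coef_eq (hq : IsPrimitiveRoot q (m + 2)) {p : Fin (m + 2) × Fin (m + 2)}
    (hp : ∀ s, p ≠ survivor m s) (φ : ℕ → ℕ → k) (n : ℕ)
    (hφ : ∀ i j, i + j = n + 1 → totalDelta (fun i j => (coefX q i j p * ·))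
      (fun i j => (coefY q i j p * ·)) φ i j = 0) :
    ∃ ψ : ℕ → ℕ → k, ∀ i j, i + j = n → totalDelta (fun i j => (coefX q i j p * ·))
      (fun i j => (coefY q i j p * ·)) ψ i j = φ i j := by
  have hl : Fin.last (m + 1) ≠ 0 := by simp [Fin.ext_iff]
  have h0 : ¬ (p.1 = 0 ∧ p.2 = 0) := fun h => hp 0 (Prod.ext h.1 h.2)
  have h1 : ¬ (p.1 = Fin.last (m + 1) ∧ p.2 = Fin.last (m + 1)) := fun h => hp 1 (Prod.ext h.1 h.2)
  have hc : ∀ i j, coefY q i j p * coefX q i (j + 1) p = coefX q i j p * coefY q (i + 1) j p :=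
    fun i j => coefY_mul_coefX hq.pow_eq_one i j p
  -- If the rows are not usable, then `p.1 = 0` or `p.2` is last. Excluding the two survivors then
  -- forces `p.1` not last and `p.2 ≠ 0`, as the columns require.
  by_cases h : p.1 ≠ 0 ∧ p.2 ≠ Fin.last (m + 1)
  · exact exists_totalDelta_eq_of_horizontal
      (fun i j hi => coefX_ne_zero hq h.1 h.2 hi j) hc φ n hφ
  · refine exists_totalDelta_eq_of_vertical (fun i j hj => coefY_ne_zero hq ?_ ?_ i hj) hc φ n hφ
    · intro h2
      exact h ⟨by rw [h2]; exact hl, fun h3 => h1 ⟨h2, h3⟩⟩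
    · intro h2
      exact h ⟨fun h3 => h0 ⟨h3, h2⟩, by rw [h2]; exact hl.symm⟩

end Coordinates

end QCI

/-! ### Computing `Ext` from an explicit free resolution. -/

section Resolution

open Limits

/-- A short complex of vector spaces whose homology is detected by a linear map. -/
lemma nonempty_homology_linearEquiv {k : Type u} [Field k] (S : ShortComplex (ModuleCat.{u} k))
    {W : Type*} [AddCommGroup W] [Module k W] (ψ : S.X₂ →ₗ[k] W)
    (hsurj : ∀ w, ∃ z, S.g z = 0 ∧ ψ z = w) (hf : ∀ y, ψ (S.f y) = 0)
    (hex : ∀ z, S.g z = 0 → ψ z = 0 → ∃ y, S.f y = z) : Nonempty (S.homology ≃ₗ[k] W) := by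
  let ψ' : LinearMap.ker S.g.hom →ₗ[k] W := ψ ∘ₗ (LinearMap.ker S.g.hom).subtype
  have hψ' : Function.Surjective ψ' := fun w => by
    obtain ⟨z, hz, rfl⟩ := hsurj w
    exact ⟨⟨z, hz⟩, rfl⟩
  have hker : LinearMap.range S.moduleCatToCycles = LinearMap.ker ψ' := by
    ext ⟨z, hz⟩
    constructor
    · rintro ⟨y, hy⟩
      have : S.f y = z := congrArg Subtype.val hy
      rw [LinearMap.mem_ker, ← hf y, this]
      rfl
    · intro h
      obtain ⟨y, hy⟩ := hex z hz h
      exact ⟨y, Subtype.ext hy⟩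
  exact ⟨S.moduleCatHomologyIso.toLinearEquiv ≪≫ₗ Submodule.quotEquivOfEq _ _ hker ≪≫ₗ
    ψ'.quotKerEquivOfSurjective hψ'⟩

/-- `Ext` is computed by a linear map on the cochains of a projective resolution that detects
cohomology. -/
lemma nonempty_ext_linearEquiv {k : Type u} [Field k] {R : Type u} [Ring R] [Algebra k R]
    {M : ModuleCat.{u} R} (P : ProjectiveResolution M) (N : ModuleCat.{u} R) (n : ℕ)
    {W : Type*} [AddCommGroup W] [Module k W] (ψ : (P.complex.X n ⟶ N) →ₗ[k] W)
    (hsurj : ∀ w, ∃ f, P.complex.d (n + 1) n ≫ f = 0 ∧ ψ f = w)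
    (hd : ∀ i (g : P.complex.X i ⟶ N), ψ (P.complex.d n i ≫ g) = 0)
    (hex : ∀ f, P.complex.d (n + 1) n ≫ f = 0 → ψ f = 0 →
      ∃ (i : ℕ) (g : P.complex.X i ⟶ N), P.complex.d n i ≫ g = f) :
    Nonempty ((((Ext k (ModuleCat.{u} R) n).obj (Opposite.op M)).obj N : ModuleCat.{u} k) ≃ₗ[k] W) := by
  let K := P.complex.linearYonedaObj k N
  let e : ((Ext k (ModuleCat.{u} R) n).obj (Opposite.op M)).obj N ≅
      (K.sc' ((ComplexShape.up ℕ).prev n) n (n + 1)).homology :=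
    P.isoExt n N ≪≫ ShortComplex.homologyMapIso (K.isoSc' _ n (n + 1) rfl (by simp))
  obtain ⟨e'⟩ := nonempty_homology_linearEquiv
    (K.sc' ((ComplexShape.up ℕ).prev n) n (n + 1)) (W := W) ψ hsurj (fun g => hd _ g)
    (fun f hf h => by
      obtain ⟨i, g, hg⟩ := hex f hf h
      -- If `i` does not precede `n`, the differential is zero, hence so is the cocycle, and the
      -- zero cochain bounds it. This covers `n = 0`, where no predecessor exists.
      by_cases hi : (ComplexShape.up ℕ).Rel i n
      · obtain rfl := (ComplexShape.up ℕ).prev_eq' hi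
        exact ⟨g, hg⟩
      · rw [P.complex.shape _ _ hi, zero_comp] at hg
        exact ⟨0, by rw [map_zero]; exact hg⟩)
  exact ⟨e.toLinearEquiv ≪≫ₗ e'⟩

variable {R : Type u} [Ring R] {P : ℕ → ModuleCat.{u} R} {d : ∀ n, P (n + 1) ⟶ P n}

lemma ChainComplex.of_d_succ (hd : ∀ n, d (n + 1) ≫ d n = 0) (n : ℕ) :
    (ChainComplex.of (fun n => P n) d hd).d (n + 1) n = d n :=
  ChainComplex.of_d (fun n => P n) d n

/-- An exact augmented complex of projective modules, as a projective resolution. -/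
noncomputable def resolutionOfExact (hproj : ∀ n, Projective (P n))
    (hd : ∀ n, d (n + 1) ≫ d n = 0)
    (hex : ∀ n z, (d n).hom z = 0 → ∃ w, (d (n + 1)).hom w = z)
    {M : ModuleCat.{u} R} (ε : P 0 ⟶ M) (hε : d 0 ≫ ε = 0) (hsurj : Function.Surjective ε.hom)
    (hex₀ : ∀ z, ε.hom z = 0 → ∃ w, (d 0).hom w = z) : ProjectiveResolution M where
  complex := ChainComplex.of (fun n => P n) d hd
  projective := hproj
  π := (ChainComplex.toSingle₀Equiv _ _).symm ⟨ε, by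
    rw [ChainComplex.of_d_succ hd]; exact hε⟩
  quasiIso := ⟨fun n => by
    cases n with
    | zero =>
      rw [ChainComplex.quasiIsoAt₀_iff, ShortComplex.quasiIso_iff_of_zeros' _ rfl rfl rfl]
      refine (ShortComplex.exact_and_epi_g_iff_of_iso
        (S₂ := ShortComplex.mk (d 0) ε hε) ?_).2 ⟨?_, ?_⟩
      · exact ShortComplex.isoMk (Iso.refl _) (Iso.refl _) (Iso.refl _)
          ((Category.id_comp _).trans
            ((ChainComplex.of_d_succ hd 0).symm.trans (Category.comp_id _).symm))
          (by
            have h := ChainComplex.toSingle₀Equiv_symm_apply_f_zero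
              (C := ChainComplex.of (fun n => P n) d hd) (X := M) ε
              (by rw [ChainComplex.of_d_succ hd]; exact hε)
            refine (Category.id_comp ε).trans ?_
            conv_lhs => rw [← h]
            exact (Category.comp_id _).symm)
      · rw [ShortComplex.moduleCat_exact_iff]
        exact hex₀
      · exact (ModuleCat.epi_iff_surjective _).2 hsurj
    | succ n =>
      rw [quasiIsoAt_iff_exactAt' (hL := ChainComplex.exactAt_succ_single_obj ..),
          HomologicalComplex.exactAt_iff' _ (n + 2) (n + 1) n (by simp) (by simp),
          ShortComplex.moduleCat_exact_iff]
      intro z hz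
      have h1 := ChainComplex.of_d_succ hd (n + 1)
      have h0 := ChainComplex.of_d_succ hd n
      obtain ⟨w, hw⟩ := hex n z (by rw [← h0]; exact hz)
      refine ⟨w, ?_⟩
      rw [← h1] at hw
      exact hw⟩

end Resolution

/-- `totalDelta` is the transpose of `totalD` under the pairing of coefficients with values on
generators. The zero in position `0` of `seqShift` accounts for the missing boundary terms. -/
lemma sum_totalD {k R M : Type*} [Field k] [Ring R] [Algebra k R] [AddCommGroup M] [Module k M]
    (ρ : R →ₐ[k] Module.End k M) (dX dY : ℕ → ℕ → R) (G : ℕ → ℕ → M) (n : ℕ)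
    (z : Fin (n + 2) → R) :
    ∑ i : Fin (n + 1), ρ (totalD dX dY n z i) (G i (n - i)) =
      ∑ i : Fin (n + 2), ρ (z i) (totalDelta (fun i j => ρ (dX i j)) (fun i j => ρ (dY i j)) G
        i (n + 1 - i)) := by
  simp only [totalDelta, map_add, Finset.sum_add_distrib, totalD_apply, LinearMap.add_apply, map_mul,
    Module.End.mul_apply]
  congr 1
  · conv_rhs => rw [Fin.sum_univ_succ]
    simp [seqShift_zero, seqShift_succ]
  · conv_rhs => rw [Fin.sum_univ_castSucc]
    simp only [Fin.val_last, Nat.sub_self, seqShift_zero, smul_zero, map_zero, add_zero]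
    refine Finset.sum_congr rfl fun i _ => ?_
    rw [Fin.val_castSucc, show n + 1 - (i : ℕ) = n - i + 1 by omega, seqShift_succ]
    rcases Nat.even_or_odd (i : ℕ) with h | h <;> simp [h.neg_one_pow]

/-! ### The free resolution of `A`, its cochains, and the dimension count. -/

namespace QCI

open EnvelopingAlgebra

variable {k : Type u} [Field k] {a : ℕ} {q : k}

variable (k a q) in
/-- The regular bimodule of the quantum complete intersection. -/
noncomputable abbrev bimod : ModuleCat.{u} (EnvelopingAlgebra k (QCI k a q)) :=
  regularBimodule k (QCI k a q)

variable (k a q) in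
/-- The underlying group of the regular bimodule is the algebra. -/
noncomputable def algEquiv : QCI k a q ≃+ bimod k a q := AddEquiv.refl (QCI k a q)

lemma smul_algEquiv (t : EnvelopingAlgebra k (QCI k a q)) (b : QCI k a q) :
    t • algEquiv k a q b = algEquiv k a q (act k a q t b) := rfl

variable (k a q) in
/-- The differential of the resolution. -/
noncomputable abbrev resD (n : ℕ) :=
  ModuleCat.ofHom (totalD (dX k a q) (dY k a q) n)

variable (k a q) in
/-- The augmentation of the resolution. -/
noncomputable def augmentation :
    (Fin 1 → EnvelopingAlgebra k (QCI k a q)) →ₗ[EnvelopingAlgebra k (QCI k a q)] bimod k a q where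
  toFun z := algEquiv k a q (act k a q (z 0) 1)
  map_add' z w := by
    rw [Pi.add_apply, map_add, LinearMap.add_apply, map_add]
  map_smul' t z := by
    rw [Pi.smul_apply, smul_eq_mul, map_mul, Module.End.mul_apply, RingHom.id_apply,
      smul_algEquiv]

variable (k a q) in
/-- The augmentation of the resolution, as a morphism of bimodules. -/
noncomputable def augmentationHom :
    ModuleCat.of (EnvelopingAlgebra k (QCI k a q)) (Fin 1 → EnvelopingAlgebra k (QCI k a q)) ⟶
      bimod k a q :=
  let f : ModuleCat.of (EnvelopingAlgebra k (QCI k a q))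
      (Fin 1 → EnvelopingAlgebra k (QCI k a q)) ⟶
      ModuleCat.of (EnvelopingAlgebra k (QCI k a q)) (bimod k a q) :=
    ModuleCat.ofHom (augmentation k a q)
  f

lemma augmentation_apply (z : Fin 1 → EnvelopingAlgebra k (QCI k a q)) :
    (augmentationHom k a q).hom z = algEquiv k a q (act k a q (z 0) 1) := rfl

lemma resD_comp (ha : 1 ≤ a) (hqa : q ^ a = 1) (n : ℕ) :
    resD k a q (n + 1) ≫ resD k a q n = 0 :=
  ModuleCat.hom_ext (LinearMap.ext fun z =>
    totalD_comp dX_mul_dX dY_mul_dY (dX_mul_dY ha hqa) n z)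

/-- The free bimodule resolution of the quantum complete intersection. -/
noncomputable def resolution (ha : 1 ≤ a) (hqa : q ^ a = 1) (hq : q ≠ 0) :
    ProjectiveResolution (bimod k a q) :=
  resolutionOfExact
    (P := fun n => ModuleCat.of (EnvelopingAlgebra k (QCI k a q))
      (Fin (n + 1) → EnvelopingAlgebra k (QCI k a q)))
    (d := resD k a q)
    (fun n => ModuleCat.projective_of_free (Pi.basisFun _ _))
    (resD_comp ha hqa)
    (fun n z hz => exists_totalD_eq
      (hX := fun i j => (hX ha hq i j).toAddMonoidHom) (hY := fun j => (hY ha hq j).toAddMonoidHom)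
      dX_mul_dX (dX_mul_dY ha hqa) (hX_mul_dX_add ha hq) (hX_mul_dY ha hq hqa)
      (hY_mul_dY_add ha hq) n z hz)
    (augmentationHom k a q)
    (by
      refine ModuleCat.hom_ext (LinearMap.ext fun z => ?_)
      have h1 : act k a q (dX k a q 0 0) 1 = 0 := by
        simpa [twist] using act_dX_even (k := k) (a := a) (q := q) (i := 0) (by simp) 0 0 0
      have h2 : act k a q (dY k a q 0 0) 1 = 0 := by
        simpa [twist] using act_dY_even (k := k) (a := a) (q := q) (j := 0) (by simp) 0 0 0
      change algEquiv k a q (act k a q (totalD (dX k a q) (dY k a q) 0 z 0) 1) = 0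
      rw [totalD_apply, Fin.val_zero, pow_zero, one_mul, map_add, map_mul, map_mul,
        LinearMap.add_apply, Module.End.mul_apply, Module.End.mul_apply, h1, h2, map_zero, map_zero,
        add_zero, map_zero])
    (fun b => by
      refine ⟨fun _ => inl ((algEquiv k a q).symm b), ?_⟩
      rw [augmentation_apply, inl, AlgHom.mulLeftRight_apply, unop_one, mul_one, mul_one,
        AddEquiv.apply_symm_apply])
    (fun z hz => exists_totalD_zero_eq
      (hX := fun i j => (hX ha hq i j).toAddMonoidHom) (hY := fun j => (hY ha hq j).toAddMonoidHom)
      (eq_add_of_origin ha hq (z 0) ((map_eq_zero_iff _ (algEquiv k a q).injective).1 hz)))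

lemma resolution_d (ha : 1 ≤ a) (hqa : q ^ a = 1) (hq : q ≠ 0) (n : ℕ) :
    (resolution ha hqa hq).complex.d (n + 1) n = resD k a q n :=
  ChainComplex.of_d_succ (P := fun n => ModuleCat.of (EnvelopingAlgebra k (QCI k a q))
      (Fin (n + 1) → EnvelopingAlgebra k (QCI k a q))) (d := resD k a q) (resD_comp ha hqa) n

/-- The values of a cochain on the resolution, prescribed on the generators. -/
noncomputable def cochainLinear (G : ℕ → ℕ → QCI k a q) (n : ℕ) :
    (Fin (n + 1) → EnvelopingAlgebra k (QCI k a q)) →ₗ[EnvelopingAlgebra k (QCI k a q)]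
      bimod k a q where
  toFun z := algEquiv k a q (∑ i, act k a q (z i) (G i (n - i)))
  map_add' z w := by
    simp only [Pi.add_apply, map_add, LinearMap.add_apply, Finset.sum_add_distrib]
  map_smul' t z := by
    simp only [Pi.smul_apply, smul_eq_mul, map_mul, Module.End.mul_apply, RingHom.id_apply,
      smul_algEquiv, map_sum (act k a q t)]

/-- The cochain on the resolution with prescribed values on the generators. -/
noncomputable def cochain (G : ℕ → ℕ → QCI k a q) (n : ℕ) :
    ModuleCat.of (EnvelopingAlgebra k (QCI k a q)) (Fin (n + 1) → EnvelopingAlgebra k (QCI k a q)) ⟶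
      bimod k a q :=
  let f : ModuleCat.of (EnvelopingAlgebra k (QCI k a q))
      (Fin (n + 1) → EnvelopingAlgebra k (QCI k a q)) ⟶
      ModuleCat.of (EnvelopingAlgebra k (QCI k a q)) (bimod k a q) :=
    ModuleCat.ofHom (cochainLinear G n)
  f

lemma cochain_apply (G : ℕ → ℕ → QCI k a q) (n : ℕ)
    (z : Fin (n + 1) → EnvelopingAlgebra k (QCI k a q)) :
    (cochain G n).hom z = algEquiv k a q (∑ i, act k a q (z i) (G i (n - i))) := rfl

lemma cochain_single (G : ℕ → ℕ → QCI k a q) (n : ℕ) (i : Fin (n + 1)) :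
    (cochain G n).hom (Pi.single i 1) = algEquiv k a q (G i (n - i)) := by
  rw [cochain_apply, Finset.sum_eq_single i]
  · simp
  · intro j _ hj
    simp [hj]
  · simp

lemma exists_eq_cochain {n : ℕ} (f : ModuleCat.of (EnvelopingAlgebra k (QCI k a q))
    (Fin (n + 1) → EnvelopingAlgebra k (QCI k a q)) ⟶ bimod k a q) : ∃ G, f = cochain G n := by
  -- In degree `n` the second index is determined as `n - i`, so it can be ignored.
  refine ⟨fun i _ => if h : i < n + 1 then (algEquiv k a q).symm (f.hom (Pi.single ⟨i, h⟩ 1)) else 0, ?_⟩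
  refine ModuleCat.hom_ext ?_
  refine (Pi.basisFun _ _).ext fun i => ?_
  rw [Pi.basisFun_apply, cochain_single, dif_pos i.2, AddEquiv.apply_symm_apply]

/-- The cochain differential on families of values. -/
noncomputable abbrev delta (G : ℕ → ℕ → QCI k a q) : ℕ → ℕ → QCI k a q :=
  totalDelta (fun i j => act k a q (dX k a q i j)) (fun i j => act k a q (dY k a q i j)) G

lemma resD_comp_cochain (G : ℕ → ℕ → QCI k a q) (n : ℕ) :
    resD k a q n ≫ cochain G n = cochain (delta G) (n + 1) := by
  refine ModuleCat.hom_ext (LinearMap.ext fun z => ?_)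
  change algEquiv k a q
    (∑ i : Fin (n + 1), act k a q (totalD (dX k a q) (dY k a q) n z i) (G i (n - i))) =
    algEquiv k a q (∑ i : Fin (n + 2), act k a q (z i) (delta G i (n + 1 - i)))
  exact congrArg _ (sum_totalD (act k a q) (dX k a q) (dY k a q) G n z)

lemma cochain_eq_iff {G G' : ℕ → ℕ → QCI k a q} {n : ℕ} :
    cochain G n = cochain G' n ↔ ∀ i j, i + j = n → G i j = G' i j := by
  constructor
  · rintro h i j rfl
    have := congrArg (fun f => f.hom (Pi.single (⟨i, by omega⟩ : Fin (i + j + 1)) 1)) h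
    have h' := (algEquiv k a q).injective
      ((cochain_single G (i + j) ⟨i, by omega⟩).symm.trans
        (this.trans (cochain_single G' (i + j) ⟨i, by omega⟩)))
    simpa only [Nat.add_sub_cancel_left] using h'
  · intro h
    refine ModuleCat.hom_ext (LinearMap.ext fun z => ?_)
    rw [cochain_apply, cochain_apply]
    refine congrArg _ (Finset.sum_congr rfl fun i _ => by rw [h i (n - i) (by omega)])

variable {m : ℕ}

lemma repr_act_dX {q : k} (hq : q ≠ 0) (i j : ℕ) (p : Fin (m + 2) × Fin (m + 2))
    (b : QCI k (m + 2) q) :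
    (shiftedBasis hq (i + 1) j).repr (act k (m + 2) q (dX k (m + 2) q i j) b) p =
      coefX q i j p * (shiftedBasis hq i j).repr b p := by
  suffices h : (shiftedBasis hq (i + 1) j).coord p ∘ₗ act k (m + 2) q (dX k (m + 2) q i j) =
      coefX q i j p • (shiftedBasis hq i j).coord p from LinearMap.congr_fun h b
  refine (shiftedBasis hq i j).ext fun r => ?_
  simp only [LinearMap.comp_apply, LinearMap.smul_apply, act_dX_shiftedBasis, map_smul,
    Module.Basis.coord_apply, Module.Basis.repr_self, smul_eq_mul]
  by_cases h : r = p
  · subst h; rfl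
  · simp [h]

lemma repr_act_dY {q : k} (hq : q ≠ 0) (i j : ℕ) (p : Fin (m + 2) × Fin (m + 2))
    (b : QCI k (m + 2) q) :
    (shiftedBasis hq i (j + 1)).repr (act k (m + 2) q (dY k (m + 2) q i j) b) p =
      coefY q i j p * (shiftedBasis hq i j).repr b p := by
  suffices h : (shiftedBasis hq i (j + 1)).coord p ∘ₗ act k (m + 2) q (dY k (m + 2) q i j) =
      coefY q i j p • (shiftedBasis hq i j).coord p from LinearMap.congr_fun h b
  refine (shiftedBasis hq i j).ext fun r => ?_
  simp only [LinearMap.comp_apply, LinearMap.smul_apply, act_dY_shiftedBasis, map_smul,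
    Module.Basis.coord_apply, Module.Basis.repr_self, smul_eq_mul]
  by_cases h : r = p
  · subst h; rfl
  · simp [h]

/-- Diagonality of both differentials decouples the cochain complex into one scalar double complex
for each label `p`. -/
lemma repr_delta {q : k} (hq : q ≠ 0) (G : ℕ → ℕ → QCI k (m + 2) q) (i j : ℕ)
    (p : Fin (m + 2) × Fin (m + 2)) :
    (shiftedBasis hq i j).repr (delta G i j) p =
      totalDelta (fun i j => (coefX q i j p * ·)) (fun i j => (coefY q i j p * ·))
        (fun i j => (shiftedBasis hq i j).repr (G i j) p) i j := by
  unfold delta totalDelta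
  rw [map_add, Finsupp.add_apply, map_zsmul, Finsupp.smul_apply]
  congr 2
  · cases i with
    | zero => simp [seqShift_zero]
    | succ i => exact repr_act_dX hq i j p _
  · cases j with
    | zero => simp [seqShift_zero]
    | succ j => exact repr_act_dY hq i j p _

lemma totalDelta_survivor {q : k} (hq : IsPrimitiveRoot q (m + 2)) (s : Fin 2) (φ : ℕ → ℕ → k)
    (i j : ℕ) : totalDelta (fun i j => (coefX q i j (survivor m s) * ·))
      (fun i j => (coefY q i j (survivor m s) * ·)) φ i j = 0 := by
  unfold totalDelta
  simp only [coefX_survivor hq, coefY_survivor hq, zero_mul]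
  cases i <;> cases j <;> simp [seqShift]

/-- A cocycle without components in the surviving bidegrees is a coboundary. -/
lemma exists_delta_eq {q : k} (hq : IsPrimitiveRoot q (m + 2)) (hq0 : q ≠ 0)
    (G : ℕ → ℕ → QCI k (m + 2) q) (n : ℕ)
    (hG : ∀ i j, i + j = n + 1 → delta G i j = 0)
    (hs : ∀ i j s, i + j = n → (shiftedBasis hq0 i j).repr (G i j) (survivor m s) = 0) :
    ∃ G', ∀ i j, i + j = n → delta G' i j = G i j := by
  have h : ∀ p : Fin (m + 2) × Fin (m + 2), ∃ ψ : ℕ → ℕ → k, ∀ i j, i + j = n →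
      totalDelta (fun i j => (coefX q i j p * ·)) (fun i j => (coefY q i j p * ·)) ψ i j =
        (shiftedBasis hq0 i j).repr (G i j) p := by
    intro p
    by_cases hp : ∀ s, p ≠ survivor m s
    · refine exists_totalDelta_coef_eq hq hp _ n fun i j hij => ?_
      rw [← repr_delta, hG i j hij, map_zero, Finsupp.zero_apply]
    · push Not at hp
      obtain ⟨s, rfl⟩ := hp
      -- On a surviving label the differential is zero, but so is the component of `G`.
      exact ⟨0, fun i j hij => by rw [totalDelta_survivor hq, hs i j s hij]⟩
  choose ψ hψ using h
  refine ⟨fun i j => ∑ p, ψ p i j • shiftedBasis hq0 i j p, fun i j hij => ?_⟩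
  refine (shiftedBasis hq0 i j).repr.injective (Finsupp.ext fun p => ?_)
  rw [repr_delta, ← hψ p i j hij]
  congr 1
  ext i j
  rw [Module.Basis.repr_sum_self]

/-- The components of a cochain in the surviving bidegrees. -/
noncomputable def survivingPart {q : k} (hq : q ≠ 0) (n : ℕ) :
    (ModuleCat.of (EnvelopingAlgebra k (QCI k (m + 2) q))
      (Fin (n + 1) → EnvelopingAlgebra k (QCI k (m + 2) q)) ⟶ bimod k (m + 2) q) →ₗ[k]
      (Fin (n + 1) × Fin 2 → k) where
  toFun f := fun p => (shiftedBasis hq p.1 (n - p.1)).repr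
    ((algEquiv k (m + 2) q).symm (f.hom (Pi.single p.1 1))) (survivor m p.2)
  map_add' f g := by
    ext p
    rw [ModuleCat.hom_add, LinearMap.add_apply, map_add, map_add]
    rfl
  map_smul' r f := by
    ext p
    have h : (algEquiv k (m + 2) q).symm ((r • f).hom (Pi.single p.1 1)) =
        r • (algEquiv k (m + 2) q).symm (f.hom (Pi.single p.1 1)) := by
      change act k (m + 2) q (algebraMap k _ r) _ = _
      rw [AlgHom.commutes]
      rfl
    rw [h, map_smul]
    rfl

lemma survivingPart_cochain {q : k} (hq : q ≠ 0) (n : ℕ) (G : ℕ → ℕ → QCI k (m + 2) q)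
    (p : Fin (n + 1) × Fin 2) : survivingPart hq n (cochain G n) p =
      (shiftedBasis hq p.1 (n - p.1)).repr (G p.1 (n - p.1)) (survivor m p.2) := by
  change (shiftedBasis hq p.1 (n - p.1)).repr
    ((algEquiv k (m + 2) q).symm ((cochain G n).hom (Pi.single p.1 1))) (survivor m p.2) = _
  rw [cochain_single, AddEquiv.symm_apply_apply]

lemma cochain_zero (n : ℕ) : cochain (0 : ℕ → ℕ → QCI k a q) n = 0 := by
  refine ModuleCat.hom_ext (LinearMap.ext fun z => ?_)
  rw [cochain_apply]
  simp only [Pi.zero_apply, map_zero, Finset.sum_const_zero]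
  rfl

/-- `survivingPart` detects cohomology: coboundaries have no surviving components, any choice of
these extends to a cocycle, and a cocycle without them is a coboundary. -/
lemma nonempty_hochschildCohomology_equiv {q : k} (hq : IsPrimitiveRoot q (m + 2)) (n : ℕ) :
    Nonempty (HochschildCohomology k (QCI k (m + 2) q) n ≃ₗ[k] (Fin (n + 1) × Fin 2 → k)) := by
  have hq0 : q ≠ 0 := hq.ne_zero (by omega)
  have hd : ∀ n, (resolution (a := m + 2) (by omega) hq.pow_eq_one hq0).complex.d (n + 1) n =
      resD k (m + 2) q n := resolution_d _ _ _
  have hclosed : ∀ (G : ℕ → ℕ → QCI k (m + 2) q) (n : ℕ), resD k (m + 2) q n ≫ cochain G n = 0 ↔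
      ∀ i j, i + j = n + 1 → delta G i j = 0 := fun G n => by
    rw [resD_comp_cochain, ← cochain_zero, cochain_eq_iff]
    rfl
  refine nonempty_ext_linearEquiv (resolution (a := m + 2) (by omega) hq.pow_eq_one hq0)
    (bimod k (m + 2) q) n (survivingPart hq0 n) ?_ ?_ ?_
  · intro w
    -- Combinations of surviving basis vectors are automatically cocycles, since every differential
    -- vanishes on them.
    let G : ℕ → ℕ → QCI k (m + 2) q := fun i j =>
      if h : i < n + 1 then ∑ s, w (⟨i, h⟩, s) • shiftedBasis hq0 i j (survivor m s) else 0
    have hG : ∀ i j p, (∀ s, p ≠ survivor m s) → (shiftedBasis hq0 i j).repr (G i j) p = 0 := by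
      intro i j p hp
      dsimp only [G]
      split_ifs with h
      · rw [map_sum, Finsupp.finsetSum_apply]
        refine Finset.sum_eq_zero fun s _ => ?_
        simp [(hp s).symm]
      · simp
    refine ⟨cochain G n, ?_, ?_⟩
    · rw [hd]
      refine (hclosed G n).2 fun i j _ => ?_
      refine (shiftedBasis hq0 i j).repr.injective (Finsupp.ext fun p => ?_)
      rw [repr_delta, map_zero, Finsupp.zero_apply]
      by_cases hp : ∀ s, p ≠ survivor m s
      · simp only [hG _ _ p hp]
        unfold totalDelta
        cases i <;> cases j <;> simp [seqShift]
      · push Not at hp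
        obtain ⟨s, rfl⟩ := hp
        rw [totalDelta_survivor hq]
    · ext p
      refine (survivingPart_cochain hq0 n G p).trans ?_
      have hp : (p.1 : ℕ) < n + 1 := p.1.2
      dsimp only [G]
      rw [dif_pos hp, map_sum, Finsupp.finsetSum_apply, Finset.sum_eq_single p.2]
      · simp
      · intro s _ hs
        simp [survivor_injective.ne hs]
      · simp
  · intro i g
    by_cases hi : i + 1 = n
    · subst hi
      obtain ⟨G, rfl⟩ := exists_eq_cochain g
      rw [hd]
      refine (congrArg (survivingPart hq0 (i + 1)) (resD_comp_cochain G i)).trans ?_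
      ext p
      rw [survivingPart_cochain, repr_delta, totalDelta_survivor hq]
      rfl
    · rw [HomologicalComplex.shape _ _ _ hi, Limits.zero_comp]
      exact map_zero (survivingPart hq0 n)
  · intro f hf hψ
    obtain ⟨G, rfl⟩ := exists_eq_cochain f
    rw [hd] at hf
    obtain ⟨G', hG'⟩ := exists_delta_eq hq hq0 G n ((hclosed G n).1 hf) (by
      rintro i j s rfl
      have := (survivingPart_cochain hq0 (i + j) G (⟨i, by omega⟩, s)).symm.trans
        (congrFun hψ (⟨i, by omega⟩, s))
      simpa using this)
    cases n with
    | zero =>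
      -- In degree `0` there are no incoming differentials: `delta G' 0 0` is zero by the convention
      -- of `seqShift`, so the cocycle itself is zero.
      refine ⟨0, 0, ?_⟩
      rw [Limits.comp_zero]
      refine ((cochain_zero 0).symm.trans (cochain_eq_iff.2 fun i j hij => ?_))
      obtain ⟨rfl, rfl⟩ : i = 0 ∧ j = 0 := by omega
      rw [← hG' 0 0 rfl]
      simp [totalDelta, seqShift]
    | succ n =>
      refine ⟨n, cochain G' n, ?_⟩
      rw [hd]
      exact (resD_comp_cochain G' n).trans (cochain_eq_iff.2 hG')

end QCI

theorem corollary3p2 {k : Type u} [Field k] (n : ℕ) :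
    (∀ (a : ℕ) (q : k), 2 ≤ a → IsPrimitiveRoot q a →
      Module.Finite k (HochschildCohomology k (QCI k a q) n) ∧
      Module.finrank k (HochschildCohomology k (QCI k a q) n) = 2 * n + 2) ∧
    (∀ (a b : ℕ) (q r : k), 2 ≤ a → 2 ≤ b → IsPrimitiveRoot q a → IsPrimitiveRoot r b →
      Module.finrank k (HochschildCohomology k (QCI k a q) n) =
        Module.finrank k (HochschildCohomology k (QCI k b r) n)) := by
  have key : ∀ (a : ℕ) (q : k), 2 ≤ a → IsPrimitiveRoot q a →
      Module.Finite k (HochschildCohomology k (QCI k a q) n) ∧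
      Module.finrank k (HochschildCohomology k (QCI k a q) n) = 2 * n + 2 := by
    intro a q ha hq
    obtain ⟨m, rfl⟩ := Nat.exists_eq_add_of_le' ha
    obtain ⟨e⟩ := QCI.nonempty_hochschildCohomology_equiv hq n
    refine ⟨Module.Finite.equiv e.symm, ?_⟩
    rw [e.finrank_eq, Module.finrank_fintype_fun_eq_card, Fintype.card_prod, Fintype.card_fin,
      Fintype.card_fin]
    ring
  exact ⟨key, fun a b q r ha hb hq hr => by rw [(key a q ha hq).2, (key b r hb hr).2]⟩
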